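/- Let $\Omega\subset\mathbb R^d$ be open, $Q=\Omega\times(0,1)$, and let $\zeta_1,\dots,\zeta_r$ be an orthonormal system in $L^2(\Omega)$. Let $K,S\in L^2(\Omega^2)$, let $\mathbb P_{r,r}$ be the orthogonal projection of $L^2(\Omega^2)$ onto $\mathrm{span}\{\zeta_i\otimes\zeta_j\}$, and assume that the matrices $\mathbf K=\big(\int_{\Omega^2}K(x,y)\zeta_p(x)\zeta_q(y)\,dx\,dy\big)_{p,q}$ and $\mathbf S=\big(\int_{\Omega^2}S(x,y)\zeta_p(x)\zeta_q(y)\,dx\,dy\big)_{p,q}$ are invertible. Let $H^1=H^1(Q)$ carry the inner product $$\langle\phi,h\rangle_{H^1}=\int_\Omega\phi(x,0)h(x,0)\,dx+\int_\Omega\phi(x,1)h(x,1)\,dx+\int_0^1\!\!\int_\Omega\nabla_{t,x}\phi\cdot\nabla_{t,x}h\,dx\,dt ,$$ and let $C:L^2((0,1);\mathbb R^r)\times\mathbb R^r\times L^2(Q)\times L^2(\Omega)\times H^1\to L^2(Q)\times L^2(Q;\mathbb R^d)\times L^2(\Omega)\times L^2(\Omega)$ be the bounded operator $$C(a,b,\alpha,\beta,\phi)=\Big(-\sum_i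 a_i(t)\zeta_i(x)-\alpha-\phi_t,\ -\nabla\phi,\ -\phi(\cdot,0),\ -\sum_i b_i\zeta_i-\beta+\phi(\cdot,1)\Big).$$ For $\rho\in L^2(Q)$, $m\in L^2(Q;\mathbb R^d)$ and values $\rho(\cdot,0),\rho(\cdot,1)\in L^2(\Omega)$ at $t=0,1$ (any elements of $L^2(\Omega)$), $\rho_t+\nabla\cdot m$ is understood weakly, with no flux of $m$ through $\partial\Omega\times(0,1)$, as the functional $$\phi\mapsto-\int_0^1\!\!\int_\Omega(\phi_t\rho+\nabla\phi\cdot m)\,dx\,dt+\int_\Omega\phi(x,1)\rho(x,1)\,dx-\int_\Omega\phi(x,0)\rho(x,0)\,dx\qquad(\phi\in H^1).$$ Let $\mathcal L=\big(\Delta_{t,x},(\mathrm{Id}-\partial_t)|_{\Omega\times\{0\}},(\mathrm{Id}+\partial_t)|_{\Omega\times\{1\}}\big)$ with the homogeneous Neumann condition on $\partial\Omega\times(0,1)$; $\mathcal L h=(g,0,0)$ means that $h\in H^1$ is the weak solution, that is, for all $\phi\in H^1$, $$\int_0^1\!\!\int_\Omega\nabla_{t,x}h\cdot\nabla_{t,x}\phi\,dx\,dt=-\langle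 g,\phi\rangle-\int_\Omega h(x,0)\phi(x,0)\,dx-\int_\Omega h(x,1)\phi(x,1)\,dx.$$ Let $f_0,f_1:(0,1)\times\Omega\times\mathbb R\to\mathbb R$ and $g_0,g_1:\Omega\times\mathbb R\to\mathbb R$ be measurable and nondecreasing in the last variable $z$, with antiderivatives $F_i,G_i$ in $z$ ($\partial_zF_i=f_i$, $\partial_zG_i=g_i$). Assume that $f_i(\cdot,\cdot,0)$ and $g_i(\cdot,0)$ are square integrable, that $F_i(\cdot,\cdot,0)$ and $G_i(\cdot,0)$ are integrable, and that the coefficient integrals of the nonlocal couplings converge: for every $u\in\mathrm{span}\{\zeta_i\}$ and every $i$, $f_1(t,\cdot,u(\cdot))\zeta_i$ (for almost every $t$, independent of $u$) and $g_1(\cdot,u(\cdot))\zeta_i$ are integrable on $\Omega$. Put $$U_0(\rho)=\int_0^1\!\!\int_\Omega F_0(t,x,\rho)\,dx\,dt,\quad V_0(\mu)=\int_\Omega G_0(x,\mu)\,dx,$$ $$U_1(c)=\int_0^1\!\!\int_\Omega F_1\Big(t,x,\sum_pc_p(t)\zeta_p(x)\Big)dx\,dt,\quad V_1(w)=\int_\Omega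 G_1\Big(x,\sum_pw_p\zeta_p(x)\Big)dx$$ on $L^2(Q)$, $L^2(\Omega)$, $L^2((0,1);\mathbb R^r)$, $\mathbb R^r$, with values in $(-\infty,+\infty]$ (the value is $+\infty$ where the integrand is not integrable). Let $J^*(y)=\sup_x\langle y,x\rangle-J(x)$ denote the convex dual and $\partial$ the subdifferential of convex analysis, and let $$M(a,b,\alpha,\beta,\phi)=\big(\mathbf K^{-1}\partial U_1^*(a),\ \mathbf S^{-1}\partial V_1^*(b),\ \partial U_0^*(\alpha),\ \partial V_0^*(\beta),\ 0\big),$$ where $\mathbf K^{-1}$ acts pointwise in $t$. Then: (i) For all $\rho,m,\rho(\cdot,0),\rho(\cdot,1)$ as above, the equation $\mathcal Lh=(\rho_t+\nabla\cdot m,0,0)$ has exactly one solution $h=\mathcal L^{-1}(\rho_t+\nabla\cdot m,0,0)\in H^1$, and the Hilbert space adjoint of $C$ is $$C^*(\rho,m,\rho(\cdot,0),\rho(\cdot,1))=\Big(\big(-\!\int_\Omega\rho(x,t)\zeta_i(x)dx\big)_i,\ \big(-\!\int_\Omega\rho(x,1)\zeta_i(x)dx\big)_i,\ -\rho,\ -\rho(\cdot,1),\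 -\mathcal L^{-1}(\rho_t+\nabla\cdot m,0,0)\Big).$$ (ii) For all $(a,b,\alpha,\beta,\phi)$ and all $\rho,m,\rho(\cdot,0),\rho(\cdot,1)$ in these spaces, the compatibility conditions $$\begin{cases}a_i(t)=\int_\Omega f_1\big(t,x,\int_\Omega\mathbb P_{r,r}(K)(x,y)\rho(y,t)\,dy\big)\zeta_i(x)\,dx\quad\text{for all } i \text{ and a.e. } t,\\ b_i=\int_\Omega g_1\big(x,\int_\Omega\mathbb P_{r,r}(S)(x,y)\rho(y,1)\,dy\big)\zeta_i(x)\,dx\quad\text{for all } i,\\ \alpha(x,t)=f_0(t,x,\rho(x,t))\quad\text{a.e.},\qquad \beta(x)=g_0(x,\rho(x,1))\quad\text{a.e.},\\ \rho_t+\nabla\cdot m=0\end{cases}$$ hold if and only if $-C^*(\rho,m,\rho(\cdot,0),\rho(\cdot,1))\in M(a,b,\alpha,\beta,\phi)$. -/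

import Mathlib

open MeasureTheory Set

open scoped ContDiff

noncomputable section

namespace MFG

/-- The state space `ℝ^d` with its Euclidean norm. -/
abbrev Sp (d : ℕ) : Type := EuclideanSpace ℝ (Fin d)

/-- Lebesgue measure on `Ω`. -/
abbrev muX {d : ℕ} (Ω : TopologicalSpace.Opens (Sp d)) : Measure (Sp d) :=
  volume.restrict (Ω : Set (Sp d))

/-- Lebesgue measure on the time interval `(0,1)`. -/
abbrev muT : Measure ℝ := volume.restrict (Ioo (0 : ℝ) 1)

/-- Lebesgue measure on the space-time cylinder `Q = Ω × (0,1)`; its points are `z = (x,t)`. -/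
abbrev muQ {d : ℕ} (Ω : TopologicalSpace.Opens (Sp d)) : Measure (Sp d × ℝ) :=
  (muX Ω).prod muT

/-- `L²(Ω)`. -/
abbrev L2X {d : ℕ} (Ω : TopologicalSpace.Opens (Sp d)) : Type := Lp ℝ 2 (muX Ω)

/-- `L²(Ω × (0,1))`. -/
abbrev L2Q {d : ℕ} (Ω : TopologicalSpace.Opens (Sp d)) : Type := Lp ℝ 2 (muQ Ω)

/-- `L²(Ω × (0,1); ℝ^d)`. -/
abbrev L2Qd {d : ℕ} (Ω : TopologicalSpace.Opens (Sp d)) : Type := Lp (Sp d) 2 (muQ Ω)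

/-- `L²((0,1); ℝ^r)`. -/
abbrev L2T (r : ℕ) : Type := Lp (EuclideanSpace ℝ (Fin r)) 2 muT

/-! ### The space `H¹(Ω × (0,1))` -/

/-- `ψ ∈ C_c^∞(U)`. -/
def IsTest {d : ℕ} (U : Set (Sp d × ℝ)) (ψ : Sp d × ℝ → ℝ) : Prop :=
  ContDiff ℝ ∞ ψ ∧ HasCompactSupport ψ ∧ tsupport ψ ⊆ U

/-- `p = u_t` and `v = ∇u` in the sense of distributions on `Ω × (0,1)`. -/
def IsWeakGrad {d : ℕ} {Ω : TopologicalSpace.Opens (Sp d)} (u p : L2Q Ω) (v : L2Qd Ω) : Prop :=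
  ∀ ψ : Sp d × ℝ → ℝ, IsTest ((Ω : Set (Sp d)) ×ˢ Ioo (0 : ℝ) 1) ψ →
    (∫ z, u z * fderiv ℝ ψ z (0, 1) ∂(muQ Ω) = - ∫ z, p z * ψ z ∂(muQ Ω)) ∧
    ∀ e : Sp d, ∫ z, u z * fderiv ℝ ψ z (e, 0) ∂(muQ Ω) = - ∫ z, inner ℝ (v z) e * ψ z ∂(muQ Ω)

/-- `u₀` and `u₁` are the traces of `u` on `Ω × {0}` and `Ω × {1}`, where `p = u_t`: integration by
parts in time holds against every `ψ ∈ C_c^∞(Ω × ℝ)`, which need not vanish at `t = 0, 1`. -/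
def IsTrace {d : ℕ} {Ω : TopologicalSpace.Opens (Sp d)} (u p : L2Q Ω) (u₀ u₁ : L2X Ω) : Prop :=
  ∀ ψ : Sp d × ℝ → ℝ, IsTest ((Ω : Set (Sp d)) ×ˢ univ) ψ →
    (∫ z, u z * fderiv ℝ ψ z (0, 1) ∂(muQ Ω)) + ∫ z, p z * ψ z ∂(muQ Ω) =
      (∫ x, u₁ x * ψ (x, 1) ∂(muX Ω)) - ∫ x, u₀ x * ψ (x, 0) ∂(muX Ω)

lemma IsTest.add {d : ℕ} {U : Set (Sp d × ℝ)} {χ η : Sp d × ℝ → ℝ} (h : IsTest U χ)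
    (h' : IsTest U η) : IsTest U (χ + η) :=
  ⟨h.1.add h'.1, h.2.1.add h'.2.1, (tsupport_add χ η).trans (union_subset h.2.2 h'.2.2)⟩

lemma IsTest.smul {d : ℕ} {U : Set (Sp d × ℝ)} {χ : Sp d × ℝ → ℝ} (c : ℝ) (h : IsTest U χ) :
    IsTest U (c • χ) :=
  ⟨h.1.const_smul c, h.2.1.smul_left (f := fun _ => c),
    (closure_mono (Function.support_const_smul_subset c χ)).trans h.2.2⟩

lemma IsTest.memLp {d : ℕ} {U : Set (Sp d × ℝ)} {χ : Sp d × ℝ → ℝ} (h : IsTest U χ)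
    (Ω : TopologicalSpace.Opens (Sp d)) : MemLp χ 2 (muQ Ω) := by
  rw [muQ, Measure.prod_restrict, ← Measure.volume_eq_prod]
  exact (h.1.continuous.memLp_of_hasCompactSupport h.2.1).restrict _

/-- The primitive in time of a test function, cut off for large times. -/
lemma IsTest.primitive {d : ℕ} {Ω : TopologicalSpace.Opens (Sp d)} {χ : Sp d × ℝ → ℝ}
    (h : IsTest ((Ω : Set (Sp d)) ×ˢ Ioo (0 : ℝ) 1) χ) :
    ∃ ψ : Sp d × ℝ → ℝ, IsTest ((Ω : Set (Sp d)) ×ˢ univ) ψ ∧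
      (∀ x, ∀ t ∈ Icc (0 : ℝ) 1, ψ (x, t) = ∫ s in (0 : ℝ)..t, χ (x, s)) ∧
      ∀ x, ∀ t ∈ Ioo (0 : ℝ) 1, fderiv ℝ ψ (x, t) (0, 1) = χ (x, t) := by
  obtain ⟨hs, hc, hsup⟩ := h
  have hz : ∀ x s, s ∉ Ioo (0 : ℝ) 1 → χ (x, s) = 0 := fun x s hs' =>
    image_eq_zero_of_notMem_tsupport fun hm => hs' (hsup hm).2
  have hz' : ∀ x s, x ∉ Prod.fst '' tsupport χ → χ (x, s) = 0 := fun x s hx =>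
    image_eq_zero_of_notMem_tsupport fun hm => hx ⟨_, hm, rfl⟩
  have hcont : ∀ x, Continuous fun s => χ (x, s) := fun x =>
    hs.continuous.comp (by fun_prop)
  set f : ℝ → ℝ := (Ici (0 : ℝ)).indicator fun _ => 1
  set Ψ : Sp d × ℝ → ℝ := fun q =>
    MeasureTheory.convolution f (fun s => χ (q.1, s)) (ContinuousLinearMap.lsmul ℝ ℝ) volume q.2
  have hΨs : ContDiff ℝ ∞ Ψ := by
    have := contDiffOn_convolution_right_with_param (𝕜 := ℝ) (μ := (volume : Measure ℝ)) (f := f)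
      (n := ⊤) (ContinuousLinearMap.lsmul ℝ ℝ) (g := fun (x : Sp d) s => χ (x, s)) isOpen_univ
      (isCompact_Icc (a := (0 : ℝ)) (b := 1))
      (fun x s _ h' => hz x s fun h2 => h' (Ioo_subset_Icc_self h2))
      ((locallyIntegrable_const (1 : ℝ)).indicator measurableSet_Ici) hs.contDiffOn
    rw [univ_prod_univ, contDiffOn_univ] at this
    exact this
  have hΨv : ∀ x, ∀ t, 0 ≤ t → Ψ (x, t) = ∫ s in (0 : ℝ)..t, χ (x, s) := by
    intro x t ht
    have h1 : Ψ (x, t) = ∫ s, (Ici (0 : ℝ)).indicator (fun s => χ (x, t - s)) s := by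
      simp only [Ψ, MeasureTheory.convolution, f]
      refine integral_congr_ae (.of_forall fun s => ?_)
      by_cases hs0 : s ∈ Ici (0 : ℝ) <;> simp [indicator, hs0]
    have h2 : ∀ s, (Ici (0 : ℝ)).indicator (fun s => χ (x, t - s)) s
        = (fun s => (Iic t).indicator (fun s => χ (x, s)) s) (t - s) := by
      intro s
      by_cases hs0 : (0 : ℝ) ≤ s <;> simp [indicator, hs0]
    rw [h1]
    simp_rw [h2]
    rw [integral_sub_left_eq_self (fun s => (Iic t).indicator (fun s => χ (x, s)) s),
      intervalIntegral.integral_of_le ht, ← integral_indicator measurableSet_Ioc]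
    refine integral_congr_ae (.of_forall fun s => ?_)
    by_cases h0 : 0 < s
    · by_cases h1 : s ≤ t <;> simp [indicator, h0, h1]
    · have : χ (x, s) = 0 := hz x s fun hm => h0 hm.1
      simp [indicator, h0, this]
  have hΨz : ∀ x t, x ∉ Prod.fst '' tsupport χ → Ψ (x, t) = 0 := by
    intro x t hx
    simp [Ψ, MeasureTheory.convolution, hz' x _ hx]
  let θ : ContDiffBump (0 : ℝ) := ⟨2, 3, by norm_num, by norm_num⟩
  have hθ : ∀ t ∈ Icc (-2 : ℝ) 2, θ t = 1 := fun t ht =>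
    θ.one_of_mem_closedBall (by
      rw [Metric.mem_closedBall, Real.dist_eq, sub_zero]; exact abs_le.2 ht)
  have hK : IsCompact ((Prod.fst '' tsupport χ) ×ˢ tsupport θ) :=
    (hc.isCompact.image continuous_fst).prod θ.hasCompactSupport.isCompact
  have hsub : Function.support (fun q : Sp d × ℝ => θ q.2 * Ψ q) ⊆
      (Prod.fst '' tsupport χ) ×ˢ tsupport θ := by
    rintro ⟨x, t⟩ hq
    simp only [Function.mem_support, ne_eq, mul_eq_zero, not_or] at hq
    exact ⟨by by_contra hx; exact hq.2 (hΨz x t hx), subset_tsupport _ hq.1⟩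
  have hts : tsupport (fun q : Sp d × ℝ => θ q.2 * Ψ q) ⊆
      (Prod.fst '' tsupport χ) ×ˢ tsupport θ := closure_minimal hsub hK.isClosed
  refine ⟨fun q => θ q.2 * Ψ q, ⟨?_, ?_, ?_⟩, ?_, ?_⟩
  · exact (θ.contDiff.comp contDiff_snd).mul hΨs
  · exact hK.of_isClosed_subset (isClosed_tsupport _) hts
  · intro q hq
    obtain ⟨⟨q', hq', he⟩, -⟩ := hts hq
    exact ⟨he ▸ (hsup hq').1, mem_univ _⟩
  · intro x t ht
    simp only
    rw [hθ t ⟨by linarith [ht.1], by linarith [ht.2]⟩, one_mul, hΨv x t ht.1]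
  · intro x t ht
    have e1 : (fun q : Sp d × ℝ => θ q.2 * Ψ q) =ᶠ[nhds (x, t)] Ψ := by
      have : ∀ᶠ q : Sp d × ℝ in nhds (x, t), q.2 ∈ Ioo (0 : ℝ) 1 :=
        continuous_snd.continuousAt.eventually (isOpen_Ioo.mem_nhds ht)
      filter_upwards [this] with q hq
      rw [hθ q.2 ⟨by linarith [hq.1], by linarith [hq.2]⟩, one_mul]
    rw [e1.fderiv_eq]
    have d1 : HasDerivAt (fun s => Ψ (x, s)) (fderiv ℝ Ψ (x, t) (0, 1)) t := by
      have hd : HasFDerivAt Ψ (fderiv ℝ Ψ (x, t)) (x, t) :=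
        (hΨs.differentiable (by simp) _).hasFDerivAt
      exact hd.comp_hasDerivAt t ((hasDerivAt_const t x).prodMk (hasDerivAt_id t))
    have d2 : HasDerivAt (fun s => Ψ (x, s)) (χ (x, t)) t := by
      have := intervalIntegral.integral_hasDerivAt_right
        ((hcont x).intervalIntegrable 0 t) ((hcont x).stronglyMeasurableAtFilter _ _)
        (hcont x).continuousAt
      refine this.congr_of_eventuallyEq ?_
      filter_upwards [isOpen_Ioo.mem_nhds ht] with s hs'
      exact hΨv x s hs'.1.le
    exact d1.unique d2

lemma sq_interval_le {g : ℝ → ℝ} (hg : Continuous g) {t : ℝ} (ht : t ∈ Icc (0 : ℝ) 1) :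
    (∫ s in (0 : ℝ)..t, g s) ^ 2 ≤ ∫ s, g s ^ 2 ∂muT := by
  set I := ∫ s in (0 : ℝ)..t, g s with hI
  have h0 : 0 ≤ ∫ s in (0 : ℝ)..t, (g s - I) ^ 2 :=
    intervalIntegral.integral_nonneg ht.1 fun s _ => sq_nonneg _
  have h1 : ∫ s in (0 : ℝ)..t, (g s - I) ^ 2 = (∫ s in (0 : ℝ)..t, g s ^ 2) - 2 * I * I + t * I ^ 2 := by
    have : ∀ s, (g s - I) ^ 2 = g s ^ 2 - 2 * I * g s + I ^ 2 := fun s => by ring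
    simp_rw [this]
    rw [intervalIntegral.integral_add, intervalIntegral.integral_sub,
      intervalIntegral.integral_const_mul, intervalIntegral.integral_const, ← hI]
    · simp
    all_goals exact Continuous.intervalIntegrable (by fun_prop) _ _
  have h2 : ∫ s in (0 : ℝ)..t, g s ^ 2 ≤ ∫ s in (0 : ℝ)..1, g s ^ 2 :=
    intervalIntegral.integral_mono_interval le_rfl ht.1 ht.2 (.of_forall fun s => sq_nonneg _)
      (Continuous.intervalIntegrable (by fun_prop) _ _)
  have h3 : ∫ s in (0 : ℝ)..1, g s ^ 2 = ∫ s, g s ^ 2 ∂muT := by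
    rw [intervalIntegral.integral_of_le zero_le_one, integral_Ioc_eq_integral_Ioo]
  nlinarith [mul_nonneg (sub_nonneg.2 ht.2) (sq_nonneg I)]

lemma abs_integral_mul_le {α : Type*} [MeasurableSpace α] {μ : Measure α} (u : Lp ℝ 2 μ)
    {g : α → ℝ} (hg : MemLp g 2 μ) {B : ℝ} (hB : 0 ≤ B) (h : ∫ x, g x ^ 2 ∂μ ≤ B ^ 2) :
    |∫ x, u x * g x ∂μ| ≤ ‖u‖ * B := by
  have h1 : inner ℝ u (hg.toLp g) = ∫ x, u x * g x ∂μ := by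
    rw [L2.inner_def]
    refine integral_congr_ae ?_
    filter_upwards [hg.coeFn_toLp] with x hx
    simp [hx, mul_comm]
  have h2 : ‖hg.toLp g‖ ^ 2 = ∫ x, g x ^ 2 ∂μ := by
    rw [← real_inner_self_eq_norm_sq, L2.inner_def]
    refine integral_congr_ae ?_
    filter_upwards [hg.coeFn_toLp] with x hx
    simp [hx, sq]
  rw [← h1]
  refine (abs_real_inner_le_norm _ _).trans ?_
  gcongr
  exact le_of_sq_le_sq (h2.trans_le h) hB

/-- Poincaré's inequality in the time direction. -/
lemma IsTrace.norm_le {d : ℕ} {Ω : TopologicalSpace.Opens (Sp d)} {u p : L2Q Ω} {u₀ u₁ : L2X Ω}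
    (hT : IsTrace u p u₀ u₁) : ‖u‖ ≤ ‖u₁‖ + ‖p‖ := by
  let U : Set (Sp d × ℝ) := (Ω : Set (Sp d)) ×ˢ Ioo (0 : ℝ) 1
  have hU : IsOpen U := Ω.isOpen.prod isOpen_Ioo
  have hQ : muQ Ω = volume.restrict U := by
    rw [muQ, Measure.prod_restrict, ← Measure.volume_eq_prod]
  have key : ∀ χ, IsTest U χ → ∀ w : L2Q Ω, w =ᵐ[muQ Ω] χ →
      |inner ℝ u w| ≤ (‖u₁‖ + ‖p‖) * ‖w‖ := by
    intro χ hχ w hw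
    obtain ⟨ψ, hψ, hv, hd⟩ := hχ.primitive
    have hcont : ∀ x, Continuous fun s => χ (x, s) := fun x =>
      hχ.1.continuous.comp (by fun_prop)
    have hw2 : ∫ z, χ z ^ 2 ∂(muQ Ω) = ‖w‖ ^ 2 := by
      rw [← real_inner_self_eq_norm_sq, L2.inner_def]
      refine integral_congr_ae ?_
      filter_upwards [hw] with x hx
      simp [hx, sq]
    have hχi : Integrable (fun z => χ z ^ 2) (muQ Ω) := (hχ.memLp Ω).integrable_sq
    have hG : Integrable (fun x => ∫ s, χ (x, s) ^ 2 ∂muT) (muX Ω) := hχi.integral_prod_left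
    have hGv : ∫ x, (∫ s, χ (x, s) ^ 2 ∂muT) ∂(muX Ω) = ‖w‖ ^ 2 := by
      rw [← hw2, integral_prod _ hχi]
    have ae1 : ∀ᵐ z ∂(muQ Ω), z ∈ U := by
      rw [hQ]; exact ae_restrict_mem hU.measurableSet
    have h1 : inner ℝ u w = ∫ z, u z * fderiv ℝ ψ z (0, 1) ∂(muQ Ω) := by
      rw [L2.inner_def]
      refine integral_congr_ae ?_
      filter_upwards [hw, ae1] with z hz hz1
      rw [hd z.1 z.2 hz1.2, hz]
      simp [mul_comm]
    have h2 := hT ψ hψ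
    have h3 : ∫ x, u₀ x * ψ (x, 0) ∂(muX Ω) = 0 := by
      have : ∀ x, ψ (x, 0) = 0 := fun x => by rw [hv x 0 ⟨le_rfl, zero_le_one⟩]; simp
      simp [this]
    have hψ1c : Continuous fun x => ψ (x, (1 : ℝ)) := hψ.1.continuous.comp (by fun_prop)
    have hle : ∀ x, ∀ t ∈ Icc (0 : ℝ) 1, ψ (x, t) ^ 2 ≤ ∫ s, χ (x, s) ^ 2 ∂muT := by
      intro x t ht
      rw [hv x t ht]
      exact sq_interval_le (hcont x) ht
    have hψ1i : Integrable (fun x => ψ (x, (1 : ℝ)) ^ 2) (muX Ω) := by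
      refine hG.mono' (hψ1c.pow 2).aestronglyMeasurable (.of_forall fun x => ?_)
      rw [Real.norm_of_nonneg (sq_nonneg _)]
      exact hle x 1 ⟨zero_le_one, le_rfl⟩
    have h4 : |∫ x, u₁ x * ψ (x, 1) ∂(muX Ω)| ≤ ‖u₁‖ * ‖w‖ := by
      refine abs_integral_mul_le u₁ ((memLp_two_iff_integrable_sq hψ1c.aestronglyMeasurable).2 hψ1i)
        (norm_nonneg _) ?_
      rw [← hGv]
      exact integral_mono hψ1i hG fun x => hle x 1 ⟨zero_le_one, le_rfl⟩
    have h5 : |∫ z, p z * ψ z ∂(muQ Ω)| ≤ ‖p‖ * ‖w‖ := by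
      have hi := (hψ.memLp Ω).integrable_sq
      refine abs_integral_mul_le p (hψ.memLp Ω) (norm_nonneg _) ?_
      rw [integral_prod _ hi, ← hGv]
      refine integral_mono hi.integral_prod_left hG fun x => ?_
      have : ∫ t, ψ (x, t) ^ 2 ∂muT ≤ ∫ _t, (∫ s, χ (x, s) ^ 2 ∂muT) ∂muT := by
        have hpc : Continuous fun t => ψ (x, t) ^ 2 := (hψ.1.continuous.comp (by fun_prop)).pow 2
        refine integral_mono_ae ?_ (integrable_const _) ?_
        · exact (hpc.integrableOn_Icc (a := 0) (b := 1)).mono_set Ioo_subset_Icc_self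
        · filter_upwards [ae_restrict_mem measurableSet_Ioo] with t ht
          exact hle x t (Ioo_subset_Icc_self ht)
      refine this.trans (le_of_eq ?_)
      simp
    rw [h1]
    have h6 : ∫ z, u z * fderiv ℝ ψ z (0, 1) ∂(muQ Ω) =
        (∫ x, u₁ x * ψ (x, 1) ∂(muX Ω)) - ∫ z, p z * ψ z ∂(muQ Ω) := by linarith
    rw [h6, add_mul]
    exact (abs_sub _ _).trans (add_le_add h4 h5)
  let S : Submodule ℝ (L2Q Ω) :=
    { carrier := {w | ∃ χ, IsTest U χ ∧ w =ᵐ[muQ Ω] χ}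
      add_mem' := by
        rintro v w ⟨χ, h, e⟩ ⟨η, h', e'⟩
        exact ⟨_, h.add h', (Lp.coeFn_add v w).trans (e.add e')⟩
      zero_mem' := ⟨0, ⟨contDiff_const, HasCompactSupport.zero, by simp [tsupport]⟩,
        Lp.coeFn_zero _ _ _⟩
      smul_mem' := by
        rintro c w ⟨χ, h, e⟩
        exact ⟨_, h.smul c, (Lp.coeFn_smul c w).trans (e.const_smul c)⟩ }
  have hS : Dense (S : Set (L2Q Ω)) := by
    rw [Submodule.dense_iff_topologicalClosure_eq_top, Submodule.topologicalClosure_eq_top_iff,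
      Submodule.eq_bot_iff]
    intro w hw
    rw [Submodule.mem_orthogonal] at hw
    have hwi : LocallyIntegrableOn (fun z => w z) U (volume : Measure (Sp d × ℝ)) := by
      have h1 : LocallyIntegrable (fun z => w z) (volume.restrict U) := by
        rw [← hQ]
        exact (Lp.memLp w).locallyIntegrable (by norm_num)
      exact locallyIntegrableOn_of_locallyIntegrable_restrict h1
    have h0 := hU.ae_eq_zero_of_integral_contDiff_smul_eq_zero hwi fun g hg hgc hgU => by
      have hg' : IsTest U g := ⟨hg, hgc, hgU⟩
      have h1 := hw ((hg'.memLp Ω).toLp g) ⟨g, hg', (hg'.memLp Ω).coeFn_toLp⟩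
      rw [L2.inner_def] at h1
      have h2 : ∫ z, g z • w z ∂(muQ Ω) = 0 := by
        rw [← h1]
        refine integral_congr_ae ?_
        filter_upwards [(hg'.memLp Ω).coeFn_toLp] with z hz
        simp [hz, mul_comm]
      rw [← h2]
      have h4 : ∫ z in U, g z • w z = ∫ z, g z • w z ∂(muQ Ω) := by
        congr 1
        exact hQ.symm
      refine (setIntegral_eq_integral_of_forall_compl_eq_zero ?_).symm.trans h4
      intro z hz
      rw [image_eq_zero_of_notMem_tsupport fun hm => hz (hgU hm), zero_smul]
    rw [Lp.eq_zero_iff_ae_eq_zero]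
    have h3 : ∀ᵐ z ∂(volume.restrict U), w z = 0 := (ae_restrict_iff' hU.measurableSet).2 h0
    rw [← hQ] at h3
    exact h3
  have hall : ∀ w : L2Q Ω, |inner ℝ u w| ≤ (‖u₁‖ + ‖p‖) * ‖w‖ := by
    intro w
    refine hS.induction (P := fun w => |inner ℝ u w| ≤ (‖u₁‖ + ‖p‖) * ‖w‖) ?_ ?_ w
    · rintro w ⟨χ, h, e⟩
      exact key χ h w e
    · exact isClosed_le (by fun_prop) (by fun_prop)
  have := hall u
  rw [real_inner_self_eq_norm_sq, abs_of_nonneg (sq_nonneg _)] at this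
  by_contra hlt
  push Not at hlt
  nlinarith [norm_nonneg u, norm_nonneg u₁, norm_nonneg p]

/-- The ambient space of tuples `(u, u_t, ∇u, u(·,0), u(·,1))`. -/
abbrev H1Tuple {d : ℕ} (Ω : TopologicalSpace.Opens (Sp d)) : Type :=
  L2Q Ω × L2Q Ω × L2Qd Ω × L2X Ω × L2X Ω

/-- Integration against a fixed test function is a continuous functional on `L²`. -/
lemma exists_functional {α E : Type*} [MeasurableSpace α] {μ : Measure α}
    [NormedAddCommGroup E] [InnerProductSpace ℝ E] {g : α → E} (hg : MemLp g 2 μ) :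
    ∃ L : Lp E 2 μ →L[ℝ] ℝ, ∀ u : Lp E 2 μ, L u = ∫ z, inner ℝ (u z) (g z) ∂μ := by
  refine ⟨innerSL ℝ (hg.toLp g), fun u => ?_⟩
  rw [innerSL_apply_apply, L2.inner_def]
  refine integral_congr_ae ?_
  filter_upwards [hg.coeFn_toLp] with z hz
  rw [hz, real_inner_comm]

lemma IsTest.fderiv_memLp {d : ℕ} {U : Set (Sp d × ℝ)} {ψ : Sp d × ℝ → ℝ} (h : IsTest U ψ)
    (Ω : TopologicalSpace.Opens (Sp d)) (w : Sp d × ℝ) :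
    MemLp (fun z => fderiv ℝ ψ z w) 2 (muQ Ω) := by
  rw [muQ, Measure.prod_restrict, ← Measure.volume_eq_prod]
  refine (Continuous.memLp_of_hasCompactSupport ?_ (h.2.1.fderiv_apply ℝ w)).restrict _
  exact (h.1.continuous_fderiv (by simp)).clm_apply continuous_const

lemma IsTest.slice_memLp {d : ℕ} {U : Set (Sp d × ℝ)} {ψ : Sp d × ℝ → ℝ} (h : IsTest U ψ)
    (Ω : TopologicalSpace.Opens (Sp d)) (t : ℝ) :
    MemLp (fun x => ψ (x, t)) 2 (muX Ω) := by
  refine (Continuous.memLp_of_hasCompactSupport ?_ ?_).restrict _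
  · exact h.1.continuous.comp (by fun_prop)
  · refine HasCompactSupport.intro (h.2.1.isCompact.image continuous_fst) fun x hx => ?_
    exact image_eq_zero_of_notMem_tsupport fun hm => hx ⟨_, hm, rfl⟩

/-- Membership in `H¹` is a family of closed linear conditions on the tuple. -/
lemma exists_conditions {d : ℕ} (Ω : TopologicalSpace.Opens (Sp d)) :
    ∃ 𝓛 : Set (H1Tuple Ω →L[ℝ] ℝ), ∀ w : H1Tuple Ω,
      (IsWeakGrad w.1 w.2.1 w.2.2.1 ∧ IsTrace w.1 w.2.1 w.2.2.2.1 w.2.2.2.2) ↔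
        ∀ L ∈ 𝓛, L w = 0 := by
  let P1 : H1Tuple Ω →L[ℝ] L2Q Ω := .fst ℝ _ _
  let R1 : H1Tuple Ω →L[ℝ] L2Q Ω × L2Qd Ω × L2X Ω × L2X Ω := .snd ℝ _ _
  let P2 : H1Tuple Ω →L[ℝ] L2Q Ω := .comp (.fst ℝ _ _) R1
  let R2 : H1Tuple Ω →L[ℝ] L2Qd Ω × L2X Ω × L2X Ω := .comp (.snd ℝ _ _) R1
  let P3 : H1Tuple Ω →L[ℝ] L2Qd Ω := .comp (.fst ℝ _ _) R2
  let R3 : H1Tuple Ω →L[ℝ] L2X Ω × L2X Ω := .comp (.snd ℝ _ _) R2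
  let P4 : H1Tuple Ω →L[ℝ] L2X Ω := .comp (.fst ℝ _ _) R3
  let P5 : H1Tuple Ω →L[ℝ] L2X Ω := .comp (.snd ℝ _ _) R3
  have hA : ∀ ψ : Sp d × ℝ → ℝ, ∃ L : H1Tuple Ω →L[ℝ] ℝ,
      IsTest ((Ω : Set (Sp d)) ×ˢ Ioo (0 : ℝ) 1) ψ → ∀ w : H1Tuple Ω,
      L w = (∫ z, w.1 z * fderiv ℝ ψ z (0, 1) ∂(muQ Ω)) + ∫ z, w.2.1 z * ψ z ∂(muQ Ω) := by
    intro ψ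
    by_cases h : IsTest ((Ω : Set (Sp d)) ×ˢ Ioo (0 : ℝ) 1) ψ
    · obtain ⟨L1, h1⟩ := exists_functional (h.fderiv_memLp Ω (0, 1))
      obtain ⟨L2, h2⟩ := exists_functional (h.memLp Ω)
      refine ⟨L1 ∘L P1 + L2 ∘L P2, fun _ w => ?_⟩
      simp only [_root_.add_apply, ContinuousLinearMap.comp_apply, h1, h2]
      simp [P1, P2, R1, mul_comm]
    · exact ⟨0, fun h' => (h h').elim⟩
  have hB : ∀ (ψ : Sp d × ℝ → ℝ) (e : Sp d), ∃ L : H1Tuple Ω →L[ℝ] ℝ,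
      IsTest ((Ω : Set (Sp d)) ×ˢ Ioo (0 : ℝ) 1) ψ → ∀ w : H1Tuple Ω,
      L w = (∫ z, w.1 z * fderiv ℝ ψ z (e, 0) ∂(muQ Ω)) +
        ∫ z, inner ℝ (w.2.2.1 z) e * ψ z ∂(muQ Ω) := by
    intro ψ e
    by_cases h : IsTest ((Ω : Set (Sp d)) ×ˢ Ioo (0 : ℝ) 1) ψ
    · obtain ⟨L1, h1⟩ := exists_functional (h.fderiv_memLp Ω (e, 0))
      have hm : MemLp (fun z => ψ z • e) 2 (muQ Ω) :=
        ((ContinuousLinearMap.id ℝ ℝ).smulRight e).comp_memLp' (h.memLp Ω)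
      obtain ⟨L2, h2⟩ := exists_functional hm
      refine ⟨L1 ∘L P1 + L2 ∘L P3, fun _ w => ?_⟩
      simp only [_root_.add_apply, ContinuousLinearMap.comp_apply, h1, h2]
      simp [P1, P3, R2, R1, inner_smul_right, mul_comm]
    · exact ⟨0, fun h' => (h h').elim⟩
  have hC : ∀ ψ : Sp d × ℝ → ℝ, ∃ L : H1Tuple Ω →L[ℝ] ℝ,
      IsTest ((Ω : Set (Sp d)) ×ˢ univ) ψ → ∀ w : H1Tuple Ω,
      L w = ((∫ z, w.1 z * fderiv ℝ ψ z (0, 1) ∂(muQ Ω)) + ∫ z, w.2.1 z * ψ z ∂(muQ Ω)) -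
        ((∫ x, w.2.2.2.2 x * ψ (x, 1) ∂(muX Ω)) - ∫ x, w.2.2.2.1 x * ψ (x, 0) ∂(muX Ω)) := by
    intro ψ
    by_cases h : IsTest ((Ω : Set (Sp d)) ×ˢ univ) ψ
    · obtain ⟨L1, h1⟩ := exists_functional (h.fderiv_memLp Ω (0, 1))
      obtain ⟨L2, h2⟩ := exists_functional (h.memLp Ω)
      obtain ⟨L3, h3⟩ := exists_functional (h.slice_memLp Ω 1)
      obtain ⟨L4, h4⟩ := exists_functional (h.slice_memLp Ω 0)
      refine ⟨(L1 ∘L P1 + L2 ∘L P2) - (L3 ∘L P5 - L4 ∘L P4), fun _ w => ?_⟩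
      simp only [_root_.add_apply, _root_.sub_apply,
        ContinuousLinearMap.comp_apply, h1, h2, h3, h4]
      simp [P1, P2, P4, P5, R3, R2, R1, mul_comm]
    · exact ⟨0, fun h' => (h h').elim⟩
  choose LA hA using hA
  choose LB hB using hB
  choose LC hC using hC
  refine ⟨{L | (∃ ψ, IsTest ((Ω : Set (Sp d)) ×ˢ Ioo (0 : ℝ) 1) ψ ∧ (L = LA ψ ∨ ∃ e, L = LB ψ e)) ∨
    ∃ ψ, IsTest ((Ω : Set (Sp d)) ×ˢ univ) ψ ∧ L = LC ψ}, fun w => ⟨?_, fun h => ⟨?_, ?_⟩⟩⟩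
  · rintro ⟨h1, h2⟩ L (⟨ψ, hψ, rfl | ⟨e, rfl⟩⟩ | ⟨ψ, hψ, rfl⟩)
    · rw [hA ψ hψ, (h1 ψ hψ).1, neg_add_cancel]
    · rw [hB ψ e hψ, (h1 ψ hψ).2 e, neg_add_cancel]
    · rw [hC ψ hψ, h2 ψ hψ, sub_self]
  · intro ψ hψ
    refine ⟨eq_neg_of_add_eq_zero_left ?_, fun e => eq_neg_of_add_eq_zero_left ?_⟩
    · rw [← hA ψ hψ]; exact h _ (.inl ⟨ψ, hψ, .inl rfl⟩)
    · rw [← hB ψ e hψ]; exact h _ (.inl ⟨ψ, hψ, .inr ⟨e, rfl⟩⟩)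
  · intro ψ hψ
    refine sub_eq_zero.1 ?_
    rw [← hC ψ hψ]; exact h _ (.inr ⟨ψ, hψ, rfl⟩)

/-- The tuples `(u, u_t, ∇u, u(·,0), u(·,1))` with `u ∈ H¹(Ω × (0,1))`. All entries are determined
by the first one, and every `u ∈ L²` with a weak space-time gradient in `L²` has such traces, because
the cylinder is a product in time. -/
def h1Submodule {d : ℕ} (Ω : TopologicalSpace.Opens (Sp d)) : Submodule ℝ (H1Tuple Ω) where
  carrier := {w | IsWeakGrad w.1 w.2.1 w.2.2.1 ∧ IsTrace w.1 w.2.1 w.2.2.2.1 w.2.2.2.2}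
  add_mem' := by
    obtain ⟨𝓛, h⟩ := exists_conditions Ω
    intro v w hv hw
    refine (h _).2 fun L hL => ?_
    rw [map_add, (h v).1 hv L hL, (h w).1 hw L hL, add_zero]
  zero_mem' := by
    obtain ⟨𝓛, h⟩ := exists_conditions Ω
    exact (h _).2 fun L hL => map_zero L
  smul_mem' := by
    obtain ⟨𝓛, h⟩ := exists_conditions Ω
    intro c w hw
    refine (h _).2 fun L hL => ?_
    rw [map_smul, (h w).1 hw L hL, smul_zero]

lemma isClosed_h1Submodule {d : ℕ} (Ω : TopologicalSpace.Opens (Sp d)) :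
    IsClosed (h1Submodule Ω : Set (H1Tuple Ω)) := by
  obtain ⟨𝓛, h⟩ := exists_conditions Ω
  have : (h1Submodule Ω : Set (H1Tuple Ω)) = ⋂ L ∈ 𝓛, {w | L w = 0} := by
    ext w
    rw [mem_iInter₂]
    exact h w
  rw [this]
  exact isClosed_biInter fun L _ => isClosed_eq L.continuous continuous_const

/-- The Sobolev space `H¹(Ω × (0,1))`: the functions of `L²` whose weak space-time gradient is in
`L²`, together with this gradient and the traces at `t = 0` and `t = 1`. -/
def H1 {d : ℕ} (Ω : TopologicalSpace.Opens (Sp d)) : Type := h1Submodule Ω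

namespace H1

variable {d : ℕ} {Ω : TopologicalSpace.Opens (Sp d)}

instance : AddCommGroup (H1 Ω) := inferInstanceAs (AddCommGroup (h1Submodule Ω))

instance : Module ℝ (H1 Ω) := inferInstanceAs (Module ℝ (h1Submodule Ω))

/-- The inclusion of `H¹` into the space of tuples. -/
def toTuple : H1 Ω →ₗ[ℝ] H1Tuple Ω := (h1Submodule Ω).subtype

/-- The function `φ ∈ L²(Ω × (0,1))` itself. -/
def val (φ : H1 Ω) : L2Q Ω := (toTuple φ).1

/-- The weak time derivative `φ_t`. -/
def dt (φ : H1 Ω) : L2Q Ω := (toTuple φ).2.1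

/-- The weak spatial gradient `∇φ`. -/
def grad (φ : H1 Ω) : L2Qd Ω := (toTuple φ).2.2.1

/-- The trace `φ(·,0)`. -/
def tr0 (φ : H1 Ω) : L2X Ω := (toTuple φ).2.2.2.1

/-- The trace `φ(·,1)`. -/
def tr1 (φ : H1 Ω) : L2X Ω := (toTuple φ).2.2.2.2

/-- The inner product
`∫_Ω φ(x,0) h(x,0) dx + ∫_Ω φ(x,1) h(x,1) dx + ∫₀¹ ∫_Ω ∇_{t,x} φ · ∇_{t,x} h dx dt`. -/
def form (φ h : H1 Ω) : ℝ :=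
  (∫ x, φ.tr0 x * h.tr0 x ∂(muX Ω)) + (∫ x, φ.tr1 x * h.tr1 x ∂(muX Ω)) +
    ∫ z, (φ.dt z * h.dt z + inner ℝ (φ.grad z) (h.grad z)) ∂(muQ Ω)

lemma form_eq (φ h : H1 Ω) : form φ h = inner ℝ φ.tr0 h.tr0 + inner ℝ φ.tr1 h.tr1 +
    (inner ℝ φ.dt h.dt + inner ℝ φ.grad h.grad) := by
  have h2 : ∀ z, φ.dt z * h.dt z = inner ℝ (φ.dt z) (h.dt z) := fun z => by simp [mul_comm]
  have h3 : ∀ (f g : L2X Ω) x, f x * g x = inner ℝ (f x) (g x) := fun f g x => by simp [mul_comm]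
  simp only [form, h2, h3, L2.inner_def]
  rw [integral_add (L2.integrable_inner _ _) (L2.integrable_inner _ _)]

lemma norm_val_le (φ : H1 Ω) : ‖φ.val‖ ≤ ‖φ.tr1‖ + ‖φ.dt‖ := φ.2.2.norm_le

lemma form_self (φ : H1 Ω) :
    form φ φ = ‖φ.tr0‖ ^ 2 + ‖φ.tr1‖ ^ 2 + (‖φ.dt‖ ^ 2 + ‖φ.grad‖ ^ 2) := by
  simp only [form_eq, real_inner_self_eq_norm_sq]

/-- `form` is an inner product on `H¹`. -/
abbrev core : InnerProductSpace.Core ℝ (H1 Ω) where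
  inner := form
  conj_inner_symm φ h := by
    simp only [form_eq, conj_trivial, real_inner_comm]
  re_inner_nonneg φ := by
    simp only [form_self, RCLike.re_to_real]
    positivity
  add_left φ h k := by
    have e0 : (φ + h).tr0 = φ.tr0 + h.tr0 := rfl
    have e1 : (φ + h).tr1 = φ.tr1 + h.tr1 := rfl
    have e2 : (φ + h).dt = φ.dt + h.dt := rfl
    have e3 : (φ + h).grad = φ.grad + h.grad := rfl
    simp only [form_eq, e0, e1, e2, e3, inner_add_left]
    ring
  smul_left φ h c := by
    have e0 : (c • φ).tr0 = c • φ.tr0 := rfl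
    have e1 : (c • φ).tr1 = c • φ.tr1 := rfl
    have e2 : (c • φ).dt = c • φ.dt := rfl
    have e3 : (c • φ).grad = c • φ.grad := rfl
    simp only [form_eq, e0, e1, e2, e3, real_inner_smul_left, conj_trivial]
    ring
  definite φ h := by
    rw [form_self] at h
    have h0 : ‖φ.tr0‖ = 0 := by nlinarith [sq_nonneg ‖φ.tr0‖, sq_nonneg ‖φ.tr1‖, sq_nonneg ‖φ.dt‖, sq_nonneg ‖φ.grad‖]
    have h1 : ‖φ.tr1‖ = 0 := by nlinarith [sq_nonneg ‖φ.tr0‖, sq_nonneg ‖φ.tr1‖, sq_nonneg ‖φ.dt‖, sq_nonneg ‖φ.grad‖]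
    have h2 : ‖φ.dt‖ = 0 := by nlinarith [sq_nonneg ‖φ.tr0‖, sq_nonneg ‖φ.tr1‖, sq_nonneg ‖φ.dt‖, sq_nonneg ‖φ.grad‖]
    have h3 : ‖φ.grad‖ = 0 := by nlinarith [sq_nonneg ‖φ.tr0‖, sq_nonneg ‖φ.tr1‖, sq_nonneg ‖φ.dt‖, sq_nonneg ‖φ.grad‖]
    have h4 : ‖φ.val‖ = 0 :=
      le_antisymm (by have := norm_val_le φ; linarith) (norm_nonneg _)
    exact Subtype.ext (Prod.ext (norm_eq_zero.1 h4) (Prod.ext (norm_eq_zero.1 h2)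
      (Prod.ext (norm_eq_zero.1 h3) (Prod.ext (norm_eq_zero.1 h0) (norm_eq_zero.1 h1)))))

instance : NormedAddCommGroup (H1 Ω) := core.toNormedAddCommGroup

instance : InnerProductSpace ℝ (H1 Ω) := .ofCore core.toCore

lemma inner_eq (φ h : H1 Ω) : inner ℝ φ h = form φ h := rfl

lemma norm_sq_eq (φ : H1 Ω) :
    ‖φ‖ ^ 2 = ‖φ.tr0‖ ^ 2 + ‖φ.tr1‖ ^ 2 + (‖φ.dt‖ ^ 2 + ‖φ.grad‖ ^ 2) := by
  rw [← real_inner_self_eq_norm_sq, inner_eq, form_self]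

lemma norm_tr0_le (φ : H1 Ω) : ‖φ.tr0‖ ≤ ‖φ‖ := by
  refine le_of_sq_le_sq ?_ (norm_nonneg _); rw [norm_sq_eq φ]; nlinarith [sq_nonneg ‖φ.tr1‖, sq_nonneg ‖φ.dt‖, sq_nonneg ‖φ.grad‖]

lemma norm_tr1_le (φ : H1 Ω) : ‖φ.tr1‖ ≤ ‖φ‖ := by
  refine le_of_sq_le_sq ?_ (norm_nonneg _); rw [norm_sq_eq φ]; nlinarith [sq_nonneg ‖φ.tr0‖, sq_nonneg ‖φ.dt‖, sq_nonneg ‖φ.grad‖]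

lemma norm_dt_le (φ : H1 Ω) : ‖φ.dt‖ ≤ ‖φ‖ := by
  refine le_of_sq_le_sq ?_ (norm_nonneg _); rw [norm_sq_eq φ]; nlinarith [sq_nonneg ‖φ.tr0‖, sq_nonneg ‖φ.tr1‖, sq_nonneg ‖φ.grad‖]

lemma norm_grad_le (φ : H1 Ω) : ‖φ.grad‖ ≤ ‖φ‖ := by
  refine le_of_sq_le_sq ?_ (norm_nonneg _); rw [norm_sq_eq φ]; nlinarith [sq_nonneg ‖φ.tr0‖, sq_nonneg ‖φ.tr1‖, sq_nonneg ‖φ.dt‖]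

instance : CompleteSpace (H1 Ω) := by
  have hc : CompleteSpace (h1Submodule Ω) :=
    (isClosed_h1Submodule Ω).isComplete.completeSpace_coe
  let e : H1 Ω ≃ₗ[ℝ] h1Submodule Ω := LinearEquiv.refl ℝ (h1Submodule Ω)
  have he : ∀ φ : H1 Ω, ((e φ : h1Submodule Ω) : H1Tuple Ω)
      = (φ.val, φ.dt, φ.grad, φ.tr0, φ.tr1) := fun φ => rfl
  have b1 : ∀ φ : H1 Ω, ‖e φ‖ ≤ 2 * ‖φ‖ := by
    intro φ
    have h0 := norm_nonneg φ
    rw [← Submodule.norm_coe, he]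
    simp only [Prod.norm_def, max_le_iff]
    refine ⟨?_, ?_, ?_, ?_, ?_⟩
    · linarith [norm_val_le φ, norm_tr1_le φ, norm_dt_le φ]
    · linarith [norm_dt_le φ]
    · linarith [norm_grad_le φ]
    · linarith [norm_tr0_le φ]
    · linarith [norm_tr1_le φ]
  have b2 : ∀ w : h1Submodule Ω, ‖e.symm w‖ ≤ 2 * ‖w‖ := by
    intro w
    obtain ⟨φ, rfl⟩ := e.surjective w
    rw [e.symm_apply_apply]
    have hm : ‖e φ‖ = max ‖φ.val‖ (max ‖φ.dt‖ (max ‖φ.grad‖ (max ‖φ.tr0‖ ‖φ.tr1‖))) := by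
      rw [← Submodule.norm_coe, he]
      simp only [Prod.norm_def]
    have hn := norm_nonneg (e φ)
    have h2 : ‖φ.dt‖ ≤ ‖e φ‖ := by rw [hm]; simp
    have h3 : ‖φ.grad‖ ≤ ‖e φ‖ := by rw [hm]; simp
    have h4 : ‖φ.tr0‖ ≤ ‖e φ‖ := by rw [hm]; simp
    have h5 : ‖φ.tr1‖ ≤ ‖e φ‖ := by rw [hm]; simp
    refine le_of_sq_le_sq ?_ (by positivity)
    rw [norm_sq_eq φ, mul_pow]
    nlinarith [pow_le_pow_left₀ (norm_nonneg _) h2 2, pow_le_pow_left₀ (norm_nonneg _) h3 2,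
      pow_le_pow_left₀ (norm_nonneg _) h4 2, pow_le_pow_left₀ (norm_nonneg _) h5 2]
  let E := e.toContinuousLinearEquivOfBounds 2 2 b1 b2
  exact (completeSpace_congr (e := E.toEquiv) E.isUniformEmbedding).2 hc

/-- `φ ↦ φ_t` as a continuous linear map. -/
def dtL : H1 Ω →L[ℝ] L2Q Ω :=
  LinearMap.mkContinuous
    { toFun := dt, map_add' := fun _ _ => rfl, map_smul' := fun _ _ => rfl } 1
    fun φ => (norm_dt_le φ).trans_eq (one_mul _).symm

/-- `φ ↦ ∇φ` as a continuous linear map. -/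
def gradL : H1 Ω →L[ℝ] L2Qd Ω :=
  LinearMap.mkContinuous
    { toFun := grad, map_add' := fun _ _ => rfl, map_smul' := fun _ _ => rfl } 1
    fun φ => (norm_grad_le φ).trans_eq (one_mul _).symm

/-- `φ ↦ φ(·,0)` as a continuous linear map. -/
def tr0L : H1 Ω →L[ℝ] L2X Ω :=
  LinearMap.mkContinuous
    { toFun := tr0, map_add' := fun _ _ => rfl, map_smul' := fun _ _ => rfl } 1
    fun φ => (norm_tr0_le φ).trans_eq (one_mul _).symm

/-- `φ ↦ φ(·,1)` as a continuous linear map. -/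
def tr1L : H1 Ω →L[ℝ] L2X Ω :=
  LinearMap.mkContinuous
    { toFun := tr1, map_add' := fun _ _ => rfl, map_smul' := fun _ _ => rfl } 1
    fun φ => (norm_tr1_le φ).trans_eq (one_mul _).symm

end H1

/-! ### The operator `C` -/

lemma memLp_tensor {α β : Type*} [MeasurableSpace α] [MeasurableSpace β] {μ : Measure α}
    {ν : Measure β} [SFinite μ] [SFinite ν] (f : Lp ℝ 2 μ) (g : Lp ℝ 2 ν) :
    MemLp (fun z : α × β => f z.1 * g z.2) 2 (μ.prod ν) := by
  have hm : AEStronglyMeasurable (fun z : α × β => f z.1 * g z.2) (μ.prod ν) :=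
    ((Lp.aestronglyMeasurable f).comp_quasiMeasurePreserving
      Measure.quasiMeasurePreserving_fst).mul
    ((Lp.aestronglyMeasurable g).comp_quasiMeasurePreserving
      Measure.quasiMeasurePreserving_snd)
  refine (memLp_two_iff_integrable_sq hm).2 ?_
  simp_rw [mul_pow]
  exact (Lp.memLp f).integrable_sq.mul_prod (Lp.memLp g).integrable_sq

/-- The tensor product `(f ⊗ g)(x,y) = f(x) g(y)` of `L²` functions. -/
def tensor {α β : Type*} [MeasurableSpace α] [MeasurableSpace β] {μ : Measure α}
    {ν : Measure β} [SFinite μ] [SFinite ν] (f : Lp ℝ 2 μ) (g : Lp ℝ 2 ν) :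
    Lp ℝ 2 (μ.prod ν) :=
  (memLp_tensor f g).toLp

lemma coeFn_tensor {α β : Type*} [MeasurableSpace α] [MeasurableSpace β] {μ : Measure α}
    {ν : Measure β} [SFinite μ] [SFinite ν] (f : Lp ℝ 2 μ) (g : Lp ℝ 2 ν) :
    tensor f g =ᵐ[μ.prod ν] fun z => f z.1 * g z.2 :=
  (memLp_tensor f g).coeFn_toLp

/-- `g ↦ f ⊗ g` as a continuous linear map. -/
def tensorL {α β : Type*} [MeasurableSpace α] [MeasurableSpace β] {μ : Measure α}
    {ν : Measure β} [SFinite μ] [SFinite ν] (f : Lp ℝ 2 μ) : Lp ℝ 2 ν →L[ℝ] Lp ℝ 2 (μ.prod ν) :=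
  LinearMap.mkContinuous
    { toFun := tensor f
      map_add' := fun g h => by
        refine Lp.ext ?_
        have e := (Measure.quasiMeasurePreserving_snd (μ := μ) (ν := ν)).ae
          (Lp.coeFn_add g h)
        filter_upwards [coeFn_tensor f (g + h), coeFn_tensor f g, coeFn_tensor f h,
          Lp.coeFn_add (tensor f g) (tensor f h), e] with z h1 h2 h3 h4 h5
        rw [h1, h4, h5, Pi.add_apply, Pi.add_apply, h2, h3]
        ring
      map_smul' := fun c g => by
        refine Lp.ext ?_
        have e := (Measure.quasiMeasurePreserving_snd (μ := μ) (ν := ν)).ae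
          (Lp.coeFn_smul c g)
        filter_upwards [coeFn_tensor f (c • g), coeFn_tensor f g,
          Lp.coeFn_smul c (tensor f g), e] with z h1 h2 h4 h5
        rw [RingHom.id_apply, h1, h4, h5, Pi.smul_apply, Pi.smul_apply, h2]
        simp only [smul_eq_mul]
        ring }
    ‖f‖ fun g => by
      refine le_of_sq_le_sq ?_ (by positivity)
      have hsq : ∀ {γ : Type _} [MeasurableSpace γ] {m : Measure γ} (h : Lp ℝ 2 m),
          ‖h‖ ^ 2 = ∫ x, h x ^ 2 ∂m := by
        intro γ _ m h
        rw [← real_inner_self_eq_norm_sq, L2.inner_def]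
        exact integral_congr_ae (.of_forall fun x => by simp [sq])
      have hsq' : ‖f‖ ^ 2 = ∫ x, f x ^ 2 ∂μ := by
        rw [← real_inner_self_eq_norm_sq, L2.inner_def]
        exact integral_congr_ae (.of_forall fun x => by simp [sq])
      have hsq'' : ‖g‖ ^ 2 = ∫ x, g x ^ 2 ∂ν := by
        rw [← real_inner_self_eq_norm_sq, L2.inner_def]
        exact integral_congr_ae (.of_forall fun x => by simp [sq])
      rw [mul_pow, hsq', hsq'', ← integral_prod_mul, hsq]
      refine (integral_congr_ae ?_).le
      filter_upwards [coeFn_tensor f g] with z hz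
      simp only [LinearMap.coe_mk, AddHom.coe_mk]
      rw [hz, mul_pow]

/-- `a ↦ ((x,t) ↦ ∑ i, a_i(t) ζ_i(x))`, from `L²((0,1); ℝ^r)` to `L²(Ω × (0,1))`. -/
def expandT {d r : ℕ} {Ω : TopologicalSpace.Opens (Sp d)} (ζ : Fin r → L2X Ω) :
    L2T r →L[ℝ] L2Q Ω :=
  ∑ i, (tensorL (ζ i)).comp
    ((EuclideanSpace.proj i : EuclideanSpace ℝ (Fin r) →L[ℝ] ℝ).compLpL 2 muT)

/-- `b ↦ ∑ i, b_i ζ_i`, from `ℝ^r` to `L²(Ω)`. -/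
def expandX {d r : ℕ} {Ω : TopologicalSpace.Opens (Sp d)} (ζ : Fin r → L2X Ω) :
    EuclideanSpace ℝ (Fin r) →L[ℝ] L2X Ω :=
  ∑ i, (EuclideanSpace.proj i : EuclideanSpace ℝ (Fin r) →L[ℝ] ℝ).smulRight (ζ i)

/-- The Hilbert space `L²_t × l² × L²_{x,t} × L²_x × H¹_{x,t}` of the variables `(a,b,α,β,φ)`. -/
abbrev PrimalSpace {d : ℕ} (r : ℕ) (Ω : TopologicalSpace.Opens (Sp d)) : Type :=
  WithLp 2 (L2T r × WithLp 2 (EuclideanSpace ℝ (Fin r) ×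
    WithLp 2 (L2Q Ω × WithLp 2 (L2X Ω × H1 Ω))))

/-- The Hilbert space `L²_{x,t} × L²_{x,t} × L²_x × L²_x` of the variables
`(ρ, m, ρ(·,0), ρ(·,1))`. -/
abbrev DualSpace {d : ℕ} (Ω : TopologicalSpace.Opens (Sp d)) : Type :=
  WithLp 2 (L2Q Ω × WithLp 2 (L2Qd Ω × WithLp 2 (L2X Ω × L2X Ω)))

namespace PrimalSpace

variable {d r : ℕ} {Ω : TopologicalSpace.Opens (Sp d)}

/-- The component `a`. -/
def a : PrimalSpace r Ω →L[ℝ] L2T r := WithLp.fstL 2 ℝ _ _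

/-- The component `b`. -/
def b : PrimalSpace r Ω →L[ℝ] EuclideanSpace ℝ (Fin r) :=
  (WithLp.fstL 2 ℝ _ _).comp (WithLp.sndL 2 ℝ _ _)

/-- The component `α`. -/
def α : PrimalSpace r Ω →L[ℝ] L2Q Ω :=
  (WithLp.fstL 2 ℝ _ _).comp ((WithLp.sndL 2 ℝ _ _).comp (WithLp.sndL 2 ℝ _ _))

/-- The component `β`. -/
def β : PrimalSpace r Ω →L[ℝ] L2X Ω :=
  (WithLp.fstL 2 ℝ _ _).comp ((WithLp.sndL 2 ℝ _ _).comp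
    ((WithLp.sndL 2 ℝ _ _).comp (WithLp.sndL 2 ℝ _ _)))

/-- The component `φ`. -/
def φ : PrimalSpace r Ω →L[ℝ] H1 Ω :=
  (WithLp.sndL 2 ℝ _ _).comp ((WithLp.sndL 2 ℝ _ _).comp
    ((WithLp.sndL 2 ℝ _ _).comp (WithLp.sndL 2 ℝ _ _)))

end PrimalSpace

/-- The element `(ρ, m, ρ₀, ρ₁)` of `DualSpace Ω`. -/
def DualSpace.mk {d : ℕ} {Ω : TopologicalSpace.Opens (Sp d)} (ρ : L2Q Ω) (m : L2Qd Ω)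
    (ρ₀ ρ₁ : L2X Ω) : DualSpace Ω :=
  WithLp.toLp 2 (ρ, WithLp.toLp 2 (m, WithLp.toLp 2 (ρ₀, ρ₁)))

/-- The operator `C`; see `opC_apply` for its components. -/
def opC {d r : ℕ} {Ω : TopologicalSpace.Opens (Sp d)} (ζ : Fin r → L2X Ω) :
    PrimalSpace r Ω →L[ℝ] DualSpace Ω :=
  (WithLp.prodContinuousLinearEquiv 2 ℝ _ _).symm.toContinuousLinearMap.comp
    ((-(expandT ζ).comp PrimalSpace.a - PrimalSpace.α - H1.dtL.comp PrimalSpace.φ).prod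
      ((WithLp.prodContinuousLinearEquiv 2 ℝ _ _).symm.toContinuousLinearMap.comp
        ((-H1.gradL.comp PrimalSpace.φ).prod
          ((WithLp.prodContinuousLinearEquiv 2 ℝ _ _).symm.toContinuousLinearMap.comp
            ((-H1.tr0L.comp PrimalSpace.φ).prod
              (-(expandX ζ).comp PrimalSpace.b - PrimalSpace.β +
                H1.tr1L.comp PrimalSpace.φ))))))

/-- `C(a,b,α,β,φ) = (-∑ a_i ζ_i - α - φ_t, -∇φ, -φ(·,0), -∑ b_i ζ_i - β + φ(·,1))`. -/
lemma opC_apply {d r : ℕ} {Ω : TopologicalSpace.Opens (Sp d)} (ζ : Fin r → L2X Ω)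
    (s : PrimalSpace r Ω) :
    opC ζ s = DualSpace.mk
      (-expandT ζ s.a - s.α - s.φ.dt)
      (-s.φ.grad)
      (-s.φ.tr0)
      (-expandX ζ s.b - s.β + s.φ.tr1) := rfl

lemma expandT_apply {d r : ℕ} {Ω : TopologicalSpace.Opens (Sp d)} (ζ : Fin r → L2X Ω)
    (a : L2T r) : expandT ζ a =ᵐ[muQ Ω] fun z => ∑ i, a z.2 i * ζ i z.1 := by
  have h1 : expandT ζ a = ∑ i, tensor (ζ i)
      ((EuclideanSpace.proj i : EuclideanSpace ℝ (Fin r) →L[ℝ] ℝ).compLp a) := by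
    rw [expandT, _root_.sum_apply]
    rfl
  rw [h1]
  have h2 : ∀ i, ∀ᵐ z ∂(muQ Ω), tensor (ζ i)
      ((EuclideanSpace.proj i : EuclideanSpace ℝ (Fin r) →L[ℝ] ℝ).compLp a) z =
        a z.2 i * ζ i z.1 := by
    intro i
    have e := (Measure.quasiMeasurePreserving_snd (μ := muX Ω) (ν := muT)).ae
      ((EuclideanSpace.proj i : EuclideanSpace ℝ (Fin r) →L[ℝ] ℝ).coeFn_compLp a)
    filter_upwards [coeFn_tensor (ζ i)
      ((EuclideanSpace.proj i : EuclideanSpace ℝ (Fin r) →L[ℝ] ℝ).compLp a), e] with z hz hz'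
    rw [hz, hz']
    simp [mul_comm]
  filter_upwards [Lp.coeFn_finsetSum Finset.univ (fun i => tensor (ζ i)
      ((EuclideanSpace.proj i : EuclideanSpace ℝ (Fin r) →L[ℝ] ℝ).compLp a)),
    ae_all_iff.2 h2] with z hz hz'
  rw [hz, Finset.sum_apply]
  exact Finset.sum_congr rfl fun i _ => hz' i

lemma expandX_apply {d r : ℕ} {Ω : TopologicalSpace.Opens (Sp d)} (ζ : Fin r → L2X Ω)
    (b : EuclideanSpace ℝ (Fin r)) : expandX ζ b = ∑ i, b i • ζ i := by
  simp [expandX]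

/-! ### The equation `L h = (g, k₀, k₁)` -/

/-- The distribution `ρ_t + ∇·m` acting on `φ ∈ H¹`, where `ρ₀`, `ρ₁` are the values of `ρ` at
`t = 0`, `t = 1` and `m` has no flux through the lateral boundary `∂Ω × (0,1)`: for smooth data this
is `∫₀¹ ∫_Ω φ (ρ_t + ∇·m) dx dt`. -/
def spaceTimeDiv {d : ℕ} {Ω : TopologicalSpace.Opens (Sp d)} (ρ : L2Q Ω) (m : L2Qd Ω)
    (ρ₀ ρ₁ : L2X Ω) (φ : H1 Ω) : ℝ :=
  -(∫ z, (φ.dt z * ρ z + inner ℝ (φ.grad z) (m z)) ∂(muQ Ω)) +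
    (∫ x, φ.tr1 x * ρ₁ x ∂(muX Ω)) - ∫ x, φ.tr0 x * ρ₀ x ∂(muX Ω)

/-- `h` is the weak solution of `Δ_{t,x} h = g`, `h - h_t = k₀` on `Ω × {0}`, `h + h_t = k₁` on
`Ω × {1}`, with the natural (Neumann) condition on `∂Ω × (0,1)`, where `g` is a functional
on `H¹`: multiply by `φ`, integrate by parts, and replace `h_t` at `t = 0, 1` by its value. -/
def IsRobinSolution {d : ℕ} {Ω : TopologicalSpace.Opens (Sp d)} (h : H1 Ω) (g : H1 Ω → ℝ)
    (k₀ k₁ : L2X Ω) : Prop :=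
  ∀ φ : H1 Ω, ∫ z, (h.dt z * φ.dt z + inner ℝ (h.grad z) (φ.grad z)) ∂(muQ Ω) =
    -g φ + (∫ x, (k₀ x - h.tr0 x) * φ.tr0 x ∂(muX Ω)) +
      ∫ x, (k₁ x - h.tr1 x) * φ.tr1 x ∂(muX Ω)

/-! ### Convex functionals and the operator `M` -/

/-- The integral of a function whose negative part is integrable, with value `+∞` when the function
is not integrable. -/
def extIntegral {α : Type*} [MeasurableSpace α] (μ : Measure α) (f : α → ℝ) : EReal :=
  open Classical in if Integrable f μ then ((∫ x, f x ∂μ : ℝ) : EReal) else ⊤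

/-- The convex dual `J^*(y) = sup_x ⟨y,x⟩ - J(x)`. -/
def convexDual {E : Type*} [NormedAddCommGroup E] [InnerProductSpace ℝ E] (J : E → EReal) (y : E) :
    EReal :=
  ⨆ x : E, ((inner ℝ y x : ℝ) : EReal) - J x

/-- The subdifferential of convex analysis. -/
def subdifferential {E : Type*} [NormedAddCommGroup E] [InnerProductSpace ℝ E] (J : E → EReal)
    (x : E) : Set E :=
  {v | J x ≠ ⊤ ∧ ∀ y : E, J x + ((inner ℝ v (y - x) : ℝ) : EReal) ≤ J y}

/-- `U₀(ρ) = ∫₀¹ ∫_Ω F₀(t,x,ρ(x,t)) dx dt`. -/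
def funU0 {d : ℕ} {Ω : TopologicalSpace.Opens (Sp d)} (F₀ : ℝ → Sp d → ℝ → ℝ) (ρ : L2Q Ω) : EReal :=
  extIntegral (muQ Ω) fun z => F₀ z.2 z.1 (ρ z)

/-- `V₀(μ) = ∫_Ω G₀(x,μ(x)) dx`. -/
def funV0 {d : ℕ} {Ω : TopologicalSpace.Opens (Sp d)} (G₀ : Sp d → ℝ → ℝ) (μ : L2X Ω) : EReal :=
  extIntegral (muX Ω) fun x => G₀ x (μ x)

/-- `U₁(c) = ∫₀¹ ∫_Ω F₁(t,x,∑ p, c_p(t) ζ_p(x)) dx dt`. -/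
def funU1 {d r : ℕ} {Ω : TopologicalSpace.Opens (Sp d)} (ζ : Fin r → L2X Ω)
    (F₁ : ℝ → Sp d → ℝ → ℝ) (c : L2T r) : EReal :=
  extIntegral (muQ Ω) fun z => F₁ z.2 z.1 (∑ p, c z.2 p * ζ p z.1)

/-- `V₁(w) = ∫_Ω G₁(x,∑ p, w_p ζ_p(x)) dx`. -/
def funV1 {d r : ℕ} {Ω : TopologicalSpace.Opens (Sp d)} (ζ : Fin r → L2X Ω)
    (G₁ : Sp d → ℝ → ℝ) (w : EuclideanSpace ℝ (Fin r)) : EReal :=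
  extIntegral (muX Ω) fun x => G₁ x (∑ p, w p * ζ p x)

/-- The matrix `k_{pq} = ∫_{Ω²} K(x,y) ζ_p(x) ζ_q(y) dx dy`. -/
def kernelMatrix {d r : ℕ} {Ω : TopologicalSpace.Opens (Sp d)} (ζ : Fin r → L2X Ω)
    (K : Lp ℝ 2 ((muX Ω).prod (muX Ω))) : Matrix (Fin r) (Fin r) ℝ :=
  Matrix.of fun p q => ∫ z, K z * ζ p z.1 * ζ q z.2 ∂((muX Ω).prod (muX Ω))

/-- The orthogonal projection `P_{r,r}(K)` of `K` in `L²(Ω²)` onto `span {ζ_i ⊗ ζ_j}`. -/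
def projKernel {d r : ℕ} {Ω : TopologicalSpace.Opens (Sp d)} (ζ : Fin r → L2X Ω)
    (K : Lp ℝ 2 ((muX Ω).prod (muX Ω))) : Lp ℝ 2 ((muX Ω).prod (muX Ω)) :=
  have : FiniteDimensional ℝ (Submodule.span ℝ
      (range fun ij : Fin r × Fin r => tensor (ζ ij.1) (ζ ij.2))) :=
    FiniteDimensional.span_of_finite ℝ (finite_range _)
  (Submodule.span ℝ (range fun ij : Fin r × Fin r => tensor (ζ ij.1) (ζ ij.2))).starProjection K

/-- The set-valued map
`M(a,b,α,β,φ) = (K⁻¹ ∂U₁^*(a), S⁻¹ ∂V₁^*(b), ∂U₀^*(α), ∂V₀^*(β), 0)`, where the matrix `K⁻¹` acts on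
`L²((0,1); ℝ^r)` pointwise in time. -/
def opM {d r : ℕ} {Ω : TopologicalSpace.Opens (Sp d)} (ζ : Fin r → L2X Ω)
    (K S : Lp ℝ 2 ((muX Ω).prod (muX Ω))) (F₀ F₁ : ℝ → Sp d → ℝ → ℝ) (G₀ G₁ : Sp d → ℝ → ℝ)
    (s : PrimalSpace r Ω) : Set (PrimalSpace r Ω) :=
  {y | y.a ∈ ((Matrix.toEuclideanCLM (𝕜 := ℝ) (kernelMatrix ζ K)⁻¹).compLpL 2 muT) ''
        subdifferential (convexDual (funU1 ζ F₁)) s.a ∧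
      y.b ∈ (Matrix.toEuclideanCLM (𝕜 := ℝ) (kernelMatrix ζ S)⁻¹) ''
        subdifferential (convexDual (funV1 ζ G₁)) s.b ∧
      y.α ∈ subdifferential (convexDual (funU0 F₀)) s.α ∧
      y.β ∈ subdifferential (convexDual (funV0 G₀)) s.β ∧
      y.φ = 0}

/-- The compatibility conditions between `(a,b,α,β)` and `(ρ,m)`, where `ρ₀`, `ρ₁` are the values of
`ρ` at `t = 0`, `t = 1`. -/
structure Compatible {d r : ℕ} {Ω : TopologicalSpace.Opens (Sp d)} (ζ : Fin r → L2X Ω)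
    (K S : Lp ℝ 2 ((muX Ω).prod (muX Ω))) (f₀ f₁ : ℝ → Sp d → ℝ → ℝ) (g₀ g₁ : Sp d → ℝ → ℝ)
    (s : PrimalSpace r Ω) (ρ : L2Q Ω) (m : L2Qd Ω) (ρ₀ ρ₁ : L2X Ω) : Prop where
  a_eq : ∀ i, ∀ᵐ t ∂muT, s.a t i =
    ∫ x, f₁ t x (∫ y, projKernel ζ K (x, y) * ρ (y, t) ∂(muX Ω)) * ζ i x ∂(muX Ω)
  b_eq : ∀ i, s.b i =
    ∫ x, g₁ x (∫ y, projKernel ζ S (x, y) * ρ₁ y ∂(muX Ω)) * ζ i x ∂(muX Ω)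
  α_eq : ∀ᵐ z ∂(muQ Ω), s.α z = f₀ z.2 z.1 (ρ z)
  β_eq : ∀ᵐ x ∂(muX Ω), s.β x = g₀ x (ρ₁ x)
  continuity_eq : ∀ φ : H1 Ω, spaceTimeDiv ρ m ρ₀ ρ₁ φ = 0

end MFG

end

open MeasureTheory Set

open scoped ContDiff

namespace MFG

/-! ### Duality for closed convex functionals -/

section Duality

variable {E : Type*} [NormedAddCommGroup E] [InnerProductSpace ℝ E]

/-! The adjoint is found by pairing `C(a,b,α,β,φ)` with `(ρ,m,ρ₀,ρ₁)` and varying one argument at a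
time. Its last component represents the functional `ρ_t + ∇·m` in the inner product of `H¹`. This
inner product contains the two traces, so the weak form of `L h = (g,0,0)` reads `⟨h,φ⟩ = -g(φ)`
(`isRobinSolution_zero_iff`). The negative of that component is therefore a solution, the only one,
and it vanishes exactly when the continuity equation holds.

The other four components of the inclusion rest on `∂J* = (∂J)⁻¹` for a closed convex `J` with an
affine minorant (`IsExtension.mem_subdifferential_convexDual_iff`). The proof uses a proximal point
and the monotonicity of `∂J*`. Integral functionals qualify: their epigraph is closed by Fatou's
lemma, applied after subtracting the tangent of the integrand at zero, and the same tangent supplies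
the affine minorant. Each component thus becomes a statement about `∂U` or `∂V`.

To compute these subdifferentials, convexity shows that the pointwise derivative is a subgradient.
For the converse, a subgradient is the derivative of the functional in every direction along which
it stays finite both ways (`IsConvexIntegrand.integral_deriv_eq_inner`). No growth is assumed on the
integrands, so finiteness can fail in a given direction. The directions used are therefore damped by
a positive factor that keeps the functional finite and still detects the sign of the defect. For
spatial expansions the convergence of the coefficient integrals makes every direction admissible;
for coefficients depending on `t` the damping may depend on `t` only.

The nonlocal couplings are put in this form by expanding the projected kernel as `∑ k_pq ζ_p ⊗ ζ_q`
(`projKernel_eq`). The inner integral is then the expansion with coefficients `𝐊 c`, where `c`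
collects the coefficients of `ρ`, that is, the adjoint of the expansion map applied to `ρ`. Since
`𝐊` is invertible, `c ∈ 𝐊⁻¹ ∂U₁*(a)` means `𝐊 c ∈ ∂U₁*(a)`, hence `a ∈ ∂U₁(𝐊 c)`, which is the
compatibility condition. The final time is treated in the same way with `𝐒`. -/

lemma le_of_forall_mem_Ioo_le_add_mul {p q K : ℝ}
    (h : ∀ s ∈ Ioo (0 : ℝ) 1, p ≤ q + s * K) : p ≤ q := by
  have ht : Filter.Tendsto (fun s : ℝ => q + s * K) (nhdsWithin 0 (Ioi 0)) (nhds (q + 0 * K)) :=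
    ((continuous_const.add (continuous_id.mul continuous_const)).tendsto 0).mono_left
      nhdsWithin_le_nhds
  rw [zero_mul, add_zero] at ht
  refine ge_of_tendsto ht ?_
  filter_upwards [Ioo_mem_nhdsGT (zero_lt_one : (0 : ℝ) < 1)] with s hs using h s hs

/-- The proximal point: a closed convex functional on a Hilbert space with an affine minorant
has, for every `d`, a point `u` with `d - u` in its subdifferential at `u`. -/
lemma exists_proximal_point [CompleteSpace E] {D : Set E} {j : E → ℝ} (hj : ConvexOn ℝ D j)
    (hcl : IsClosed {p : E × ℝ | p.1 ∈ D ∧ j p.1 ≤ p.2}) (hne : D.Nonempty)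
    (haff : ∃ (w : E) (c : ℝ), ∀ x ∈ D, c + inner ℝ w x ≤ j x) (d : E) :
    ∃ u ∈ D, ∀ y ∈ D, j u + inner ℝ (d - u) (y - u) ≤ j y := by
  obtain ⟨w, c, hw⟩ := haff
  set Φ : E → ℝ := fun x => j x + ‖x - d‖ ^ 2 / 2 with hΦ
  have hbdd : BddBelow (Φ '' D) := by
    -- Completing the square: `⟨w,x⟩ + ‖x-d‖²/2 = ⟨w,d⟩ + ‖w+(x-d)‖²/2 - ‖w‖²/2`.
    refine ⟨c + inner ℝ w d - ‖w‖ ^ 2 / 2, ?_⟩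
    rintro _ ⟨x, hx, rfl⟩
    have h1 := hw x hx
    have h2 := norm_add_sq_real w (x - d)
    have h3 : inner ℝ w (x - d) = inner ℝ w x - inner ℝ w d := inner_sub_right _ _ _
    simp only [hΦ]
    nlinarith [sq_nonneg ‖w + (x - d)‖]
  set m := sInf (Φ '' D) with hm
  have hmle : ∀ x ∈ D, m ≤ Φ x := fun x hx => csInf_le hbdd ⟨x, hx, rfl⟩
  have hex : ∀ n : ℕ, ∃ x ∈ D, Φ x < m + 1 / ((n : ℝ) + 1) := by
    intro n
    obtain ⟨_, ⟨x, hx, rfl⟩, hlt⟩ := exists_lt_of_csInf_lt (hne.image Φ)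
      (show sInf (Φ '' D) < m + 1 / ((n : ℝ) + 1) by
        have : (0 : ℝ) < 1 / ((n : ℝ) + 1) := by positivity
        linarith)
    exact ⟨x, hx, hlt⟩
  choose x hxD hx using hex
  -- Strong convexity: by the parallelogram law the midpoint lies `‖y-z‖²/8` below the average of
  -- `Φ`, but never below `m`. Minimizing sequences are therefore Cauchy.
  have hmid : ∀ y ∈ D, ∀ z ∈ D, ‖y - z‖ ^ 2 ≤ 4 * (Φ y + Φ z - 2 * m) := by
    intro y hy z hz
    have h1 := hj.2 hy hz (by norm_num : (0 : ℝ) ≤ 1 / 2) (by norm_num : (0 : ℝ) ≤ 1 / 2)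
      (by norm_num)
    have h2 := hmle _ (hj.1 hy hz (by norm_num : (0 : ℝ) ≤ 1 / 2) (by norm_num : (0 : ℝ) ≤ 1 / 2)
      (by norm_num))
    have h3 : (1 / 2 : ℝ) • y + (1 / 2 : ℝ) • z - d = (1 / 2 : ℝ) • ((y - d) + (z - d)) := by
      rw [smul_add, smul_sub, smul_sub]
      have : d = (1 / 2 : ℝ) • d + (1 / 2 : ℝ) • d := by rw [← add_smul]; norm_num
      nth_rewrite 1 [this]
      abel
    have h4 := parallelogram_law_with_norm ℝ (y - d) (z - d)
    have h5 : y - d - (z - d) = y - z := by abel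
    rw [h5] at h4
    simp only [hΦ, h3, norm_smul, smul_eq_mul] at h1 h2 ⊢
    norm_num [mul_pow] at h2
    nlinarith
  have hcau : CauchySeq x := by
    refine cauchySeq_of_le_tendsto_0 (fun n => Real.sqrt (8 * (1 / ((n : ℝ) + 1)))) ?_ ?_
    · intro n k N hn hk
      rw [dist_eq_norm]
      refine Real.le_sqrt_of_sq_le ?_
      have h1 := hmid _ (hxD n) _ (hxD k)
      have h2 := hx n
      have h3 := hx k
      have h4 : 1 / ((n : ℝ) + 1) ≤ 1 / ((N : ℝ) + 1) := by gcongr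
      have h5 : 1 / ((k : ℝ) + 1) ≤ 1 / ((N : ℝ) + 1) := by gcongr
      linarith
    · have := (tendsto_one_div_add_atTop_nhds_zero_nat (𝕜 := ℝ)).const_mul 8
      simpa using this.sqrt
  obtain ⟨u, hu⟩ := cauchySeq_tendsto_of_complete hcau
  -- These pairs lie in the epigraph of `j`; its closedness gives `Φ u ≤ m`.
  have hlim : Filter.Tendsto
      (fun n => (x n, m + 1 / ((n : ℝ) + 1) - ‖x n - d‖ ^ 2 / 2)) Filter.atTop
      (nhds (u, m + 0 - ‖u - d‖ ^ 2 / 2)) := by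
    refine hu.prodMk_nhds (Filter.Tendsto.sub ?_ ?_)
    · exact tendsto_const_nhds.add (tendsto_one_div_add_atTop_nhds_zero_nat (𝕜 := ℝ))
    · exact ((hu.sub_const d).norm.pow 2).div_const 2
  have hmem := hcl.mem_of_tendsto hlim (.of_forall fun n => ⟨hxD n, by
    have := hx n
    simp only [hΦ] at this
    linarith⟩)
  obtain ⟨huD, hum⟩ := hmem
  simp only [add_zero] at huD hum
  refine ⟨u, huD, fun y hy => ?_⟩
  -- Minimality of `u` is compared with the point `u + s(y-u)`. Division by `s` leaves an error
  -- `s‖y-u‖²/2`, which vanishes as `s → 0`.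
  refine le_of_forall_mem_Ioo_le_add_mul (K := ‖y - u‖ ^ 2 / 2) fun s hs => ?_
  have e : (1 - s) • u + s • y = u + s • (y - u) := by
    rw [sub_smul, smul_sub, one_smul]; abel
  have h1 := hj.2 huD hy (sub_nonneg.2 hs.2.le) hs.1.le (by ring)
  have h2 := hmle _ (hj.1 huD hy (sub_nonneg.2 hs.2.le) hs.1.le (by ring))
  rw [e] at h1 h2
  have h3 : u + s • (y - u) - d = (u - d) + s • (y - u) := by abel
  have h4 := norm_add_sq_real (u - d) (s • (y - u))
  have h5 : inner ℝ (d - u) (y - u) = - inner ℝ (u - d) (y - u) := by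
    rw [← inner_neg_left, neg_sub]
  rw [real_inner_smul_right, norm_smul, Real.norm_of_nonneg hs.1.le, mul_pow] at h4
  simp only [hΦ, h3, h4, smul_eq_mul] at h1 h2
  rw [h5]
  have h6 : s * (j u + -inner ℝ (u - d) (y - u)) ≤ s * (j y + s * (‖y - u‖ ^ 2 / 2)) := by
    nlinarith
  exact le_of_mul_le_mul_left h6 hs.1

/-- The functional with values `j` on `D` and `+∞` off `D`. -/
structure IsExtension (J : E → EReal) (D : Set E) (j : E → ℝ) : Prop where
  eq_coe : ∀ x ∈ D, J x = (j x : EReal)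
  eq_top : ∀ x ∉ D, J x = ⊤

variable {J : E → EReal} {D : Set E} {j : E → ℝ}

/-- Points off `D` impose no condition, so the arithmetic in `EReal` reduces to real inequalities on
`D`. -/
lemma IsExtension.mem_subdifferential_iff (h : IsExtension J D j) {x v : E} :
    v ∈ subdifferential J x ↔ x ∈ D ∧ ∀ y ∈ D, j x + inner ℝ v (y - x) ≤ j y := by
  constructor
  · rintro ⟨h1, h2⟩
    have hx : x ∈ D := by
      by_contra hx
      exact h1 (h.eq_top x hx)
    refine ⟨hx, fun y hy => ?_⟩
    have := h2 y
    rw [h.eq_coe x hx, h.eq_coe y hy] at this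
    exact_mod_cast this
  · rintro ⟨hx, h2⟩
    refine ⟨by rw [h.eq_coe x hx]; exact EReal.coe_ne_top _, fun y => ?_⟩
    by_cases hy : y ∈ D
    · rw [h.eq_coe x hx, h.eq_coe y hy]
      exact_mod_cast h2 y hy
    · rw [h.eq_top y hy]
      exact le_top

/-- The subgradient inequality says exactly that `x` attains the supremum defining the dual at `v`.
-/
lemma IsExtension.convexDual_eq (h : IsExtension J D j) {x v : E}
    (hv : v ∈ subdifferential J x) : convexDual J v = ((inner ℝ v x - j x : ℝ) : EReal) := by
  obtain ⟨hx, h2⟩ := h.mem_subdifferential_iff.1 hv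
  refine le_antisymm (iSup_le fun y => ?_) ?_
  · by_cases hy : y ∈ D
    · rw [h.eq_coe y hy]
      have := h2 y hy
      rw [inner_sub_right] at this
      have h3 : inner ℝ v y - j y ≤ inner ℝ v x - j x := by linarith
      exact_mod_cast h3
    · rw [h.eq_top y hy]
      simp
  · refine le_iSup_of_le x ?_
    rw [h.eq_coe x hx]
    exact_mod_cast le_rfl

/-- The point `x` is optimal in the supremum at `v` and a competitor in the supremum at any other
`y`. This half of the inversion needs neither convexity nor closedness. -/
lemma IsExtension.mem_subdifferential_convexDual (h : IsExtension J D j) {x v : E}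
    (hv : v ∈ subdifferential J x) : x ∈ subdifferential (convexDual J) v := by
  have e := h.convexDual_eq hv
  refine ⟨by rw [e]; exact EReal.coe_ne_top _, fun y => ?_⟩
  obtain ⟨hx, -⟩ := h.mem_subdifferential_iff.1 hv
  rw [e]
  refine le_iSup_of_le x ?_
  rw [h.eq_coe x hx]
  have : inner ℝ v x - j x + inner ℝ x (y - v) ≤ inner ℝ y x - j x := by
    rw [inner_sub_right, real_inner_comm, real_inner_comm x y]; linarith
  exact_mod_cast this

/-- For a closed convex functional with an affine minorant, the subdifferential of the dual is the
inverse of the subdifferential. -/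
theorem IsExtension.mem_subdifferential_convexDual_iff [CompleteSpace E] (h : IsExtension J D j)
    (hj : ConvexOn ℝ D j) (hcl : IsClosed {p : E × ℝ | p.1 ∈ D ∧ j p.1 ≤ p.2})
    (hne : D.Nonempty) (haff : ∃ (w : E) (c : ℝ), ∀ x ∈ D, c + inner ℝ w x ≤ j x) {x v : E} :
    x ∈ subdifferential (convexDual J) v ↔ v ∈ subdifferential J x := by
  refine ⟨fun hx => ?_, h.mem_subdifferential_convexDual⟩
  -- If `v` is a subgradient at `x`, then `x` is the proximal point of `x + v`. So the proximal
  -- point `u` of `x + v` is taken and shown to equal `x`.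
  obtain ⟨u, huD, hu⟩ := exists_proximal_point hj hcl hne haff (x + v)
  have hu' : x + v - u ∈ subdifferential J u := h.mem_subdifferential_iff.2 ⟨huD, hu⟩
  have h1 := h.mem_subdifferential_convexDual hu'
  have e := h.convexDual_eq hu'
  obtain ⟨hne_top, hx2⟩ := hx
  have hne_bot : convexDual J v ≠ ⊥ := by
    intro hbot
    have : ((inner ℝ v u : ℝ) : EReal) - J u ≤ convexDual J v := le_iSup_of_le u le_rfl
    rw [hbot, le_bot_iff, h.eq_coe u huD, ← EReal.coe_sub] at this
    exact EReal.coe_ne_bot _ this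
  obtain ⟨q, hq⟩ : ∃ q : ℝ, convexDual J v = q := by
    lift convexDual J v to ℝ using ⟨hne_top, hne_bot⟩ with q
    exact ⟨q, rfl⟩
  -- Both `x ∈ ∂J*(v)` and `u ∈ ∂J*(x+v-u)` hold. Adding the two subgradient inequalities cancels
  -- the values of the dual and leaves `‖x-u‖² ≤ 0`.
  have a1 := hx2 (x + v - u)
  have a2 := h1.2 v
  rw [e, hq] at a1 a2
  norm_cast at a1 a2
  have e1 : x + v - u - v = x - u := by abel
  have e2 : v - (x + v - u) = -(x - u) := by abel
  rw [e1] at a1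
  rw [e2, inner_neg_right] at a2
  have a3 : inner ℝ (x - u) (x - u) = inner ℝ x (x - u) - inner ℝ u (x - u) := inner_sub_left _ _ _
  have a4 : x - u = 0 := by
    rw [← inner_self_eq_zero (𝕜 := ℝ)]
    exact le_antisymm (by linarith) real_inner_self_nonneg
  rw [sub_eq_zero] at a4
  subst a4
  rwa [add_sub_cancel_left] at hu'

end Duality

/-! ### Integral functionals -/

/-- `F` is a convex differentiable integrand with derivative `f` in the last variable. -/
structure IsConvexIntegrand {Z : Type*} [MeasurableSpace Z] (μ : Measure Z) (F f : Z → ℝ → ℝ) :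
    Prop where
  meas : Measurable (Function.uncurry f)
  mono : ∀ᵐ z ∂μ, Monotone (f z)
  deriv : ∀ᵐ z ∂μ, ∀ w, HasDerivAt (F z) (f z w) w
  memLp_zero : MemLp (fun z => f z 0) 2 μ
  integrable_zero : Integrable (fun z => F z 0) μ

/-- A monotone derivative makes `F` convex, and secant slopes to the right and left of `u` lie above
and below `f u`. -/
lemma add_deriv_mul_le {F f : ℝ → ℝ} (hm : Monotone f) (hd : ∀ w, HasDerivAt F (f w) w) (u w : ℝ) :
    F u + f u * (w - u) ≤ F w := by
  have hc : ConvexOn ℝ univ F := by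
    refine Monotone.convexOn_univ_of_deriv (fun w => (hd w).differentiableAt) ?_
    rwa [show deriv F = f from funext fun w => (hd w).deriv]
  rcases lt_trichotomy u w with h | h | h
  · have := hc.le_slope_of_hasDerivAt (mem_univ u) (mem_univ w) h (hd u)
    rw [slope_def_field, le_div_iff₀ (by linarith)] at this
    linarith
  · simp [h]
  · have := hc.slope_le_of_hasDerivAt (mem_univ w) (mem_univ u) h (hd u)
    rw [slope_def_field, div_le_iff₀ (by linarith)] at this
    nlinarith

/-- The point `p + sq` is a convex combination of `p` and `p + q`, or of `p` and `p - q`, according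
to the sign of `s`. The bound is linear in `|s|`, so it both dominates difference quotients and
shows that a small enough perturbation keeps the functional finite. -/
lemma le_add_abs_mul {F f : ℝ → ℝ} (hm : Monotone f) (hd : ∀ w, HasDerivAt F (f w) w)
    (p q : ℝ) {s : ℝ} (hs : |s| ≤ 1) :
    F (p + s * q) ≤ F p + |s| * (|F (p + q) - F p| + |F (p - q) - F p|) := by
  have ht := add_deriv_mul_le hm hd
  have a1 := ht (p + s * q) (p + q)
  have a2 := ht (p + s * q) (p - q)
  have a3 := ht (p + s * q) p
  have b1 := le_abs_self (F (p + q) - F p)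
  have b2 := le_abs_self (F (p - q) - F p)
  have b3 := abs_nonneg (F (p + q) - F p)
  have b4 := abs_nonneg (F (p - q) - F p)
  rcases le_total 0 s with h0 | h0
  · rw [abs_of_nonneg h0] at hs ⊢
    nlinarith [mul_le_mul_of_nonneg_left a1 h0,
      mul_le_mul_of_nonneg_left a3 (by linarith : (0 : ℝ) ≤ 1 - s), mul_nonneg h0 b4,
      mul_le_mul_of_nonneg_left b1 h0]
  · rw [abs_of_nonpos h0] at hs ⊢
    have h0' : 0 ≤ -s := by linarith
    nlinarith [mul_le_mul_of_nonneg_left a2 h0',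
      mul_le_mul_of_nonneg_left a3 (by linarith : (0 : ℝ) ≤ 1 + s), mul_nonneg h0' b3,
      mul_le_mul_of_nonneg_left b2 h0']

namespace IsConvexIntegrand

variable {Z : Type*} [MeasurableSpace Z] {μ : Measure Z} {F f : Z → ℝ → ℝ}

lemma tangent (h : IsConvexIntegrand μ F f) :
    ∀ᵐ z ∂μ, ∀ u w, F z u + f z u * (w - u) ≤ F z w := by
  filter_upwards [h.mono, h.deriv] with z hm hd u w using add_deriv_mul_le hm hd u w

lemma aestronglyMeasurable_deriv (h : IsConvexIntegrand μ F f) {u : Z → ℝ}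
    (hu : AEStronglyMeasurable u μ) : AEStronglyMeasurable (fun z => f z (u z)) μ :=
  (h.meas.comp_aemeasurable (aemeasurable_id.prodMk hu.aemeasurable)).aestronglyMeasurable

/-- Joint measurability is assumed of `f` only. That of `F` along `u` is recovered from `F(z,w) =
F(z,0) + w ∫₀¹ f(z,θw) dθ`. -/
lemma aestronglyMeasurable (h : IsConvexIntegrand μ F f) {u : Z → ℝ}
    (hu : AEStronglyMeasurable u μ) : AEStronglyMeasurable (fun z => F z (u z)) μ := by
  have h1 : StronglyMeasurable fun p : Z × ℝ =>
      ∫ θ, f p.1 (θ * p.2) ∂(volume.restrict (Ioc (0 : ℝ) 1)) := by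
    refine StronglyMeasurable.integral_prod_right'
      (f := fun q : (Z × ℝ) × ℝ => f q.1.1 (q.2 * q.1.2)) ?_
    exact (h.meas.comp (measurable_fst.fst.prodMk
      (measurable_snd.mul measurable_fst.snd))).stronglyMeasurable
  have h2 : AEStronglyMeasurable
      (fun z => F z 0 + u z * ∫ θ, f z (θ * u z) ∂(volume.restrict (Ioc (0 : ℝ) 1))) μ :=
    h.integrable_zero.aestronglyMeasurable.add (hu.mul
      (h1.measurable.comp_aemeasurable
        (aemeasurable_id.prodMk hu.aemeasurable)).aestronglyMeasurable)
  refine h2.congr ?_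
  filter_upwards [h.mono, h.deriv] with z hm hd
  rw [← intervalIntegral.integral_of_le zero_le_one, ← smul_eq_mul (u z),
    intervalIntegral.smul_integral_comp_mul_right, zero_mul, one_mul,
    intervalIntegral.integral_eq_sub_of_hasDerivAt (fun w _ => hd w) hm.intervalIntegrable]
  ring

/-- The part of `F` above its tangent at zero is nonnegative. -/
lemma bregman_nonneg (h : IsConvexIntegrand μ F f) :
    ∀ᵐ z ∂μ, ∀ w, 0 ≤ F z w - F z 0 - f z 0 * w := by
  filter_upwards [h.tangent] with z hz w
  have := hz 0 w
  rw [sub_zero] at this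
  linarith

lemma integrable_minorant (h : IsConvexIntegrand μ F f) (u : Lp ℝ 2 μ) :
    Integrable (fun z => F z 0 + f z 0 * u z) μ :=
  h.integrable_zero.add (h.memLp_zero.integrable_mul (Lp.memLp u))

/-- The tangent at zero is an integrable lower bound, so finiteness is only ever a question of an
upper bound. -/
lemma integrable_of_le (h : IsConvexIntegrand μ F f) (u : Lp ℝ 2 μ) {g : Z → ℝ}
    (hg : Integrable g μ) (hle : ∀ᵐ z ∂μ, F z (u z) ≤ g z) :
    Integrable (fun z => F z (u z)) μ := by
  refine integrable_of_le_of_le (h.aestronglyMeasurable (Lp.aestronglyMeasurable u)) ?_ hle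
    (h.integrable_minorant u) hg
  filter_upwards [h.bregman_nonneg] with z hz
  linarith [hz (u z)]

lemma integral_minorant (h : IsConvexIntegrand μ F f) (u : Lp ℝ 2 μ) :
    ∫ z, (F z 0 + f z 0 * u z) ∂μ =
      (∫ z, F z 0 ∂μ) + inner ℝ (h.memLp_zero.toLp _) u := by
  have hi : Integrable (fun z => f z 0 * u z) μ := h.memLp_zero.integrable_mul (Lp.memLp u)
  rw [integral_add h.integrable_zero hi, L2.inner_def]
  congr 1
  refine integral_congr_ae ?_
  filter_upwards [h.memLp_zero.coeFn_toLp] with z hz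
  simp [hz, mul_comm]

lemma minorant_le (h : IsConvexIntegrand μ F f) (u : Lp ℝ 2 μ)
    (hu : Integrable (fun z => F z (u z)) μ) :
    (∫ z, F z 0 ∂μ) + inner ℝ (h.memLp_zero.toLp _) u ≤ ∫ z, F z (u z) ∂μ := by
  rw [← h.integral_minorant]
  refine integral_mono_ae (h.integrable_minorant u) hu ?_
  filter_upwards [h.bregman_nonneg] with z hz
  linarith [hz (u z)]

/-- The epigraph of an integral functional is closed in `L²`. -/
lemma isClosed_epigraph (h : IsConvexIntegrand μ F f) :
    IsClosed {p : Lp ℝ 2 μ × ℝ | Integrable (fun z => F z (p.1 z)) μ ∧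
      ∫ z, F z (p.1 z) ∂μ ≤ p.2} := by
  refine IsSeqClosed.isClosed fun p q hp hlim => ?_
  have hlim1 : Filter.Tendsto (fun n => (p n).1) Filter.atTop (nhds q.1) :=
    (continuous_fst.tendsto q).comp hlim
  have hlim2 : Filter.Tendsto (fun n => (p n).2) Filter.atTop (nhds q.2) :=
    (continuous_snd.tendsto q).comp hlim
  obtain ⟨ns, hns, hae⟩ := (tendstoInMeasure_of_tendsto_Lp hlim1).exists_seq_tendsto_ae
  set g := h.memLp_zero.toLp _ with hg
  set I := ∫ z, F z 0 ∂μ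
  -- Subtracting the tangent at zero gives a nonnegative integrand, to which Fatou's lemma applies.
  -- The subtracted part depends continuously on `u` in `L²`.
  set B : Lp ℝ 2 μ → Z → ℝ := fun u z => F z (u z) - (F z 0 + f z 0 * u z) with hB
  have hBnn : ∀ u, 0 ≤ᵐ[μ] B u := fun u => by
    filter_upwards [h.bregman_nonneg] with z hz
    have := hz (u z)
    simp only [hB, Pi.zero_apply]
    linarith
  have hBm : ∀ u, AEStronglyMeasurable (B u) μ := fun u =>
    (h.aestronglyMeasurable (Lp.aestronglyMeasurable u)).sub
      (h.integrable_minorant u).aestronglyMeasurable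
  have hBle : ∀ n, ∫⁻ z, ENNReal.ofReal (B (p n).1 z) ∂μ ≤
      ENNReal.ofReal ((p n).2 - (I + inner ℝ g (p n).1)) := by
    intro n
    have hi : Integrable (B (p n).1) μ := (hp n).1.sub (h.integrable_minorant _)
    rw [← ofReal_integral_eq_lintegral_ofReal hi (hBnn _)]
    refine ENNReal.ofReal_le_ofReal ?_
    rw [integral_sub (hp n).1 (h.integrable_minorant _), h.integral_minorant]
    linarith [(hp n).2]
  have hR : Filter.Tendsto
      (fun n => ENNReal.ofReal ((p (ns n)).2 - (I + inner ℝ g (p (ns n)).1))) Filter.atTop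
      (nhds (ENNReal.ofReal (q.2 - (I + inner ℝ g q.1)))) := by
    refine ENNReal.tendsto_ofReal (Filter.Tendsto.sub (hlim2.comp hns.tendsto_atTop) ?_)
    exact tendsto_const_nhds.add ((tendsto_const_nhds (x := g)).inner
      (hlim1.comp hns.tendsto_atTop))
  have hfin : ∫⁻ z, ENNReal.ofReal (B q.1 z) ∂μ ≤
      ENNReal.ofReal (q.2 - (I + inner ℝ g q.1)) := by
    calc ∫⁻ z, ENNReal.ofReal (B q.1 z) ∂μ
        = ∫⁻ z, Filter.liminf (fun n => ENNReal.ofReal (B (p (ns n)).1 z)) Filter.atTop ∂μ := by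
          refine lintegral_congr_ae ?_
          filter_upwards [hae, h.deriv] with z hz hd
          refine (Filter.Tendsto.liminf_eq (ENNReal.tendsto_ofReal ?_)).symm
          refine Filter.Tendsto.sub ((hd _).continuousAt.tendsto.comp hz) ?_
          exact tendsto_const_nhds.add (tendsto_const_nhds.mul hz)
      _ ≤ Filter.liminf (fun n => ∫⁻ z, ENNReal.ofReal (B (p (ns n)).1 z) ∂μ) Filter.atTop :=
          lintegral_liminf_le' fun n => (hBm _).aemeasurable.ennreal_ofReal
      _ ≤ Filter.liminf (fun n => ENNReal.ofReal ((p (ns n)).2 - (I + inner ℝ g (p (ns n)).1)))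
            Filter.atTop := Filter.liminf_le_liminf (.of_forall fun n => hBle _)
      _ = _ := hR.liminf_eq
  have hBi : Integrable (B q.1) μ := by
    refine ⟨hBm _, ?_⟩
    rw [hasFiniteIntegral_iff_ofReal (hBnn _)]
    exact hfin.trans_lt ENNReal.ofReal_lt_top
  have hFi : Integrable (fun z => F z (q.1 z)) μ := by
    refine (hBi.add (h.integrable_minorant q.1)).congr (.of_forall fun z => ?_)
    simp [hB]
  refine ⟨hFi, ?_⟩
  -- `ENNReal.ofReal` truncates at zero, so the sign of the bound is needed to return to real
  -- numbers.
  have hnn : 0 ≤ q.2 - (I + inner ℝ g q.1) := by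
    refine ge_of_tendsto' (hlim2.sub (tendsto_const_nhds.add
      ((tendsto_const_nhds (x := g)).inner hlim1))) fun n => ?_
    have := h.minorant_le (p n).1 (hp n).1
    linarith [(hp n).2]
  rw [← ofReal_integral_eq_lintegral_ofReal hBi (hBnn _), ENNReal.ofReal_le_ofReal_iff hnn,
    integral_sub hFi (h.integrable_minorant _), h.integral_minorant] at hfin
  linarith

/-- Pointwise convexity also gives convexity of the domain, since a convex combination of integrable
values is an integrable upper bound. -/
lemma convexOn_integral (h : IsConvexIntegrand μ F f) :
    ConvexOn ℝ {u : Lp ℝ 2 μ | Integrable (fun z => F z (u z)) μ}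
      fun u => ∫ z, F z (u z) ∂μ := by
  have key : ∀ (u w : Lp ℝ 2 μ) (a b : ℝ), 0 ≤ a → 0 ≤ b → a + b = 1 →
      ∀ᵐ z ∂μ, F z ((a • u + b • w : Lp ℝ 2 μ) z) ≤ a * F z (u z) + b * F z (w z) := by
    intro u w a b ha hb hab
    filter_upwards [h.tangent, Lp.coeFn_add (a • u) (b • w), Lp.coeFn_smul a u,
      Lp.coeFn_smul b w] with z hz e1 e2 e3
    rw [e1, Pi.add_apply, e2, e3]
    simp only [Pi.smul_apply, smul_eq_mul]
    set v := a * u z + b * w z with hv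
    have h1 := mul_le_mul_of_nonneg_left (hz v (u z)) ha
    have h2 := mul_le_mul_of_nonneg_left (hz v (w z)) hb
    have h3 : a * (F z v + f z v * (u z - v)) + b * (F z v + f z v * (w z - v)) = F z v := by
      have : a * (F z v + f z v * (u z - v)) + b * (F z v + f z v * (w z - v)) =
        (a + b) * F z v + f z v * (v - (a + b) * v) := by rw [hv]; ring
      rw [this, hab]; ring
    linarith
  refine ⟨fun u hu w hw a b ha hb hab => ?_, fun u hu w hw a b ha hb hab => ?_⟩
  · exact h.integrable_of_le _ ((Integrable.const_mul hu a).add (Integrable.const_mul hw b))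
      (key u w a b ha hb hab)
  · have hi : Integrable (fun z => a * F z (u z) + b * F z (w z)) μ :=
      (Integrable.const_mul hu a).add (Integrable.const_mul hw b)
    refine (integral_mono_ae (h.integrable_of_le _ hi (key u w a b ha hb hab)) hi
      (key u w a b ha hb hab)).trans_eq ?_
    rw [integral_add (Integrable.const_mul hu a) (Integrable.const_mul hw b),
      integral_const_mul, integral_const_mul, smul_eq_mul, smul_eq_mul]

lemma isExtension {α : Type*} (F : Z → ℝ → ℝ) (T : α → Z → ℝ) :
    IsExtension (fun x : α => extIntegral μ fun z => F z (T x z))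
      {x | Integrable (fun z => F z (T x z)) μ} (fun x => ∫ z, F z (T x z) ∂μ) where
  eq_coe _ hx := if_pos hx
  eq_top _ hx := if_neg hx

variable {E : Type*} [NormedAddCommGroup E] [InnerProductSpace ℝ E]

/-- The functional `x ↦ ∫ F(z, (T x)(z)) dz`. -/
noncomputable def functional (μ : Measure Z) (F : Z → ℝ → ℝ) (T : E →L[ℝ] Lp ℝ 2 μ) (x : E) : EReal :=
  extIntegral μ fun z => F z (T x z)

lemma mem_subdifferential_iff (F : Z → ℝ → ℝ) (T : E →L[ℝ] Lp ℝ 2 μ) {x v : E} :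
    v ∈ subdifferential (functional μ F T) x ↔
      Integrable (fun z => F z (T x z)) μ ∧ ∀ y, Integrable (fun z => F z (T y z)) μ →
        ∫ z, F z (T x z) ∂μ + inner ℝ v (y - x) ≤ ∫ z, F z (T y z) ∂μ :=
  (isExtension F fun x => T x).mem_subdifferential_iff

/-- The subdifferential of the dual of an integral functional is the inverse of its
subdifferential. -/
theorem mem_subdifferential_convexDual_iff [CompleteSpace E] (h : IsConvexIntegrand μ F f)
    (T : E →L[ℝ] Lp ℝ 2 μ) {x v : E} :
    x ∈ subdifferential (convexDual (functional μ F T)) v ↔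
      v ∈ subdifferential (functional μ F T) x := by
  refine (isExtension F fun x => T x).mem_subdifferential_convexDual_iff
    (h.convexOn_integral.comp_linearMap (T : E →ₗ[ℝ] Lp ℝ 2 μ)) ?_ ⟨0, ?_⟩ ?_
  · exact h.isClosed_epigraph.preimage
      (f := fun p : E × ℝ => (T p.1, p.2)) (by fun_prop)
  · refine h.integrable_zero.congr ?_
    rw [map_zero]
    filter_upwards [Lp.coeFn_zero ℝ 2 μ] with z hz
    rw [hz, Pi.zero_apply]
  -- This vector is the Riesz representative of `y ↦ ⟨f(·,0), T y⟩`, the slope of the tangent at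
  -- zero pulled back through `T`.
  · refine ⟨(ContinuousLinearMap.adjoint (innerSL ℝ (h.memLp_zero.toLp _) ∘L T)) 1,
      ∫ z, F z 0 ∂μ, fun y hy => ?_⟩
    rw [ContinuousLinearMap.adjoint_inner_left]
    simpa using h.minorant_le (T y) hy

/-- An element of the subdifferential is the derivative in every direction along which the
functional is finite. -/
lemma integral_deriv_eq_inner (h : IsConvexIntegrand μ F f) (T : E →L[ℝ] Lp ℝ 2 μ) {x v e : E}
    (hv : v ∈ subdifferential (functional μ F T) x)
    (h1 : Integrable (fun z => F z (T x z + T e z)) μ)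
    (h2 : Integrable (fun z => F z (T x z - T e z)) μ) :
    Integrable (fun z => f z (T x z) * T e z) μ ∧
      ∫ z, f z (T x z) * T e z ∂μ = inner ℝ v e := by
  obtain ⟨h0, hle⟩ := (mem_subdifferential_iff F T).1 hv
  have hm : AEStronglyMeasurable (fun z => f z (T x z) * T e z) μ :=
    (h.aestronglyMeasurable_deriv (Lp.aestronglyMeasurable _)).mul (Lp.aestronglyMeasurable _)
  have hi : Integrable (fun z => f z (T x z) * T e z) μ := by
    -- Tangents at `T x z` squeeze the derivative between the backward and forward differences.
    refine integrable_of_le_of_le hm (g₁ := fun z => F z (T x z) - F z (T x z - T e z))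
      (g₂ := fun z => F z (T x z + T e z) - F z (T x z)) ?_ ?_ (h0.sub h2) (h1.sub h0)
    · filter_upwards [h.tangent] with z hz
      have := hz (T x z) (T x z - T e z)
      linarith
    · filter_upwards [h.tangent] with z hz
      have := hz (T x z) (T x z + T e z)
      linarith
  refine ⟨hi, ?_⟩
  have hcomb : ∀ s : ℝ, ∀ᵐ z ∂μ, T (x + s • e) z = T x z + s * T e z := by
    intro s
    rw [map_add, map_smul]
    filter_upwards [Lp.coeFn_add (T x) (s • T e), Lp.coeFn_smul s (T e)] with z e1 e2
    rw [e1, Pi.add_apply, e2]; rfl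
  have hconv : ∀ s ∈ Icc (-1 : ℝ) 1, Integrable (fun z => F z (T x z + s * T e z)) μ := by
    intro s hs
    refine integrable_of_le_of_le (g₁ := fun z => F z (T x z) + s * (f z (T x z) * T e z))
      (g₂ := fun z => (1 + s) / 2 * F z (T x z + T e z) + (1 - s) / 2 * F z (T x z - T e z))
      ?_ ?_ ?_ (h0.add (hi.const_mul s)) ((h1.const_mul _).add (h2.const_mul _))
    · exact h.aestronglyMeasurable ((Lp.aestronglyMeasurable (T x)).add
        ((Lp.aestronglyMeasurable (T e)).const_mul s))
    · filter_upwards [h.tangent] with z hz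
      have := hz (T x z) (T x z + s * T e z)
      linarith
    · filter_upwards [h.tangent] with z hz
      have a1 := hz (T x z + s * T e z) (T x z + T e z)
      have a2 := hz (T x z + s * T e z) (T x z - T e z)
      nlinarith [mul_le_mul_of_nonneg_left a1 (by linarith [hs.1] : (0 : ℝ) ≤ (1 + s) / 2),
        mul_le_mul_of_nonneg_left a2 (by linarith [hs.2] : (0 : ℝ) ≤ (1 - s) / 2)]
  have hq : ∀ s ∈ Icc (-1 : ℝ) 1,
      s * inner ℝ v e ≤ ∫ z, (F z (T x z + s * T e z) - F z (T x z)) ∂μ := by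
    intro s hs
    have hcg : (fun z => F z (T (x + s • e) z)) =ᵐ[μ] fun z => F z (T x z + s * T e z) := by
      filter_upwards [hcomb s] with z hz
      rw [hz]
    have := hle (x + s • e) ((hconv s hs).congr hcg.symm)
    rw [integral_congr_ae hcg, add_sub_cancel_left, real_inner_smul_right] at this
    rw [integral_sub (hconv s hs) h0]
    linarith
  -- Difference quotients are dominated by the two unit increments: above by `le_add_abs_mul`, below
  -- by the tangent at `T x z`.
  have hder : HasDerivAt (fun s : ℝ => ∫ z, (F z (T x z + s * T e z) - F z (T x z)) ∂μ)
      (∫ z, f z (T x z) * T e z ∂μ) 0 := by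
    rw [hasDerivAt_iff_tendsto_slope_zero]
    have hdom := tendsto_integral_filter_of_dominated_convergence (μ := μ)
      (l := nhdsWithin (0 : ℝ) {0}ᶜ)
      (F := fun s z => s⁻¹ * (F z (T x z + s * T e z) - F z (T x z)))
      (f := fun z => f z (T x z) * T e z)
      (fun z => |F z (T x z + T e z) - F z (T x z)| + |F z (T x z - T e z) - F z (T x z)|)
      ?_ ?_ ?_ ?_
    · refine hdom.congr fun s => ?_
      simp [integral_const_mul]
    · refine .of_forall fun s => AEStronglyMeasurable.const_mul (AEStronglyMeasurable.sub ?_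
        h0.aestronglyMeasurable) _
      exact h.aestronglyMeasurable ((Lp.aestronglyMeasurable (T x)).add
        ((Lp.aestronglyMeasurable (T e)).const_mul s))
    · have hnear : ∀ᶠ s in nhdsWithin (0 : ℝ) {0}ᶜ, s ∈ Ioo (-1 : ℝ) 1 :=
        nhdsWithin_le_nhds (Ioo_mem_nhds (by norm_num) (by norm_num))
      filter_upwards [hnear, self_mem_nhdsWithin] with s hs hs0
      filter_upwards [h.tangent, h.mono, h.deriv] with z hz hm hd
      set p := T x z
      set q := T e z
      have a4 := hz p (p + s * q)
      have a5 := hz p (p + q)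
      have a6 := hz p (p - q)
      have hs0' : s ≠ 0 := hs0
      have d1 := le_add_abs_mul hm hd p q (abs_le.2 ⟨hs.1.le, hs.2.le⟩)
      rw [Real.norm_eq_abs, abs_mul, abs_inv, inv_mul_le_iff₀ (abs_pos.2 hs0')]
      have b1 := le_abs_self (F z (p + q) - F z p)
      have b3 := le_abs_self (F z (p - q) - F z p)
      set A := |F z (p + q) - F z p|
      set B := |F z (p - q) - F z p|
      have hA : 0 ≤ A := abs_nonneg _
      have hB : 0 ≤ B := abs_nonneg _
      have c1 : |f z p * q| ≤ A + B := abs_le.2 ⟨by linarith, by linarith⟩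
      have c2 := mul_le_mul_of_nonneg_left c1 (abs_nonneg s)
      rw [← abs_mul] at c2
      have c3 := neg_abs_le (s * (f z p * q))
      exact abs_le.2 ⟨by linarith, by linarith⟩
    · exact (h1.sub h0).abs.add (h2.sub h0).abs
    · filter_upwards [h.deriv] with z hd
      have hd1 : HasDerivAt (fun s : ℝ => T x z + s * T e z) (T e z) 0 := by
        simpa using ((hasDerivAt_id (0 : ℝ)).mul_const (T e z)).const_add (T x z)
      have hd2 : HasDerivAt (fun s : ℝ => F z (T x z + s * T e z)) (f z (T x z) * T e z) 0 := by
        have := (hd (T x z + 0 * T e z)).comp (0 : ℝ) hd1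
        rw [zero_mul, add_zero] at this
        exact this
      have := hd2.tendsto_slope_zero
      simpa using this
  have hder2 : HasDerivAt (fun s : ℝ =>
      (∫ z, (F z (T x z + s * T e z) - F z (T x z)) ∂μ) - s * inner ℝ v e)
      ((∫ z, f z (T x z) * T e z ∂μ) - inner ℝ v e) 0 := by
    have := hder.fun_sub ((hasDerivAt_id' (0 : ℝ)).mul_const (inner ℝ v e))
    rwa [one_mul] at this
  -- The subgradient inequality on the line through `x` makes `s = 0` a minimum, so the derivative
  -- there vanishes.
  have hmin : IsLocalMin (fun s : ℝ =>
      (∫ z, (F z (T x z + s * T e z) - F z (T x z)) ∂μ) - s * inner ℝ v e) 0 := by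
    filter_upwards [Ioo_mem_nhds (by norm_num : (-1 : ℝ) < 0) (by norm_num : (0 : ℝ) < 1)]
      with s hs
    have := hq s ⟨hs.1.le, hs.2.le⟩
    simp only [zero_mul, add_zero, sub_self, integral_zero]
    linarith
  exact sub_eq_zero.1 (hmin.hasDerivAt_eq_zero hder2)

end IsConvexIntegrand

/-! ### Pairings in `L²` and subdifferentials of local functionals -/

lemma L2_inner_eq_integral_mul {α : Type*} [MeasurableSpace α] {μ : Measure α} (u v : Lp ℝ 2 μ) :
    inner ℝ u v = ∫ z, u z * v z ∂μ := by
  rw [L2.inner_def]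
  exact integral_congr_ae (.of_forall fun z => by simp [mul_comm])

lemma L2_integrable_mul {α : Type*} [MeasurableSpace α] {μ : Measure α} (u v : Lp ℝ 2 μ) :
    Integrable (fun z => u z * v z) μ :=
  (Lp.memLp u).integrable_mul (Lp.memLp v)

namespace IsConvexIntegrand

section General

variable {Z : Type*} [MeasurableSpace Z] {μ : Measure Z} {F f : Z → ℝ → ℝ}
  {E : Type*} [NormedAddCommGroup E] [InnerProductSpace ℝ E]

/-- The tangent at `u z`, evaluated at zero, gives `F(z,u) ≤ F(z,0) + f(z,u) u`. -/
lemma integrable_of_integrable_mul (h : IsConvexIntegrand μ F f) (u : Lp ℝ 2 μ)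
    (hu : Integrable (fun z => f z (u z) * u z) μ) : Integrable (fun z => F z (u z)) μ := by
  refine h.integrable_of_le u (h.integrable_zero.add hu) ?_
  filter_upwards [h.tangent] with z hz
  have := hz (u z) 0
  simp only [Pi.add_apply]
  linarith

/-- If `f(·,Tx)` represents `v`, then `v` is in the subdifferential at `x`. -/
lemma mem_subdifferential_of_integral_eq (h : IsConvexIntegrand μ F f) (T : E →L[ℝ] Lp ℝ 2 μ)
    {x v : E} (hi : ∀ e, Integrable (fun z => f z (T x z) * T e z) μ)
    (he : ∀ e, ∫ z, f z (T x z) * T e z ∂μ = inner ℝ v e) :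
    v ∈ subdifferential (functional μ F T) x := by
  have h0 := h.integrable_of_integrable_mul (T x) (hi x)
  refine (mem_subdifferential_iff F T).2 ⟨h0, fun y hy => ?_⟩
  rw [← he, ← integral_add h0 (hi _)]
  refine integral_mono_ae (h0.add (hi _)) hy ?_
  rw [map_sub]
  filter_upwards [h.tangent, Lp.coeFn_sub (T y) (T x)] with z hz e
  rw [e]
  exact hz _ _

/-- The subdifferential of a local integral functional on `L²`. -/
theorem mem_subdifferential_id_iff [SigmaFinite μ] (h : IsConvexIntegrand μ F f)
    {u v : Lp ℝ 2 μ} : v ∈ subdifferential (functional μ F (.id ℝ _)) u ↔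
      ∀ᵐ z ∂μ, v z = f z (u z) := by
  constructor
  · intro hv
    obtain ⟨h0, -⟩ := (mem_subdifferential_iff F _).1 hv
    simp only [ContinuousLinearMap.id_apply] at h0
    obtain ⟨w, hwpos, hwm, hwi⟩ := exists_pos_lintegral_lt_of_sigmaFinite μ (one_ne_zero (α := ENNReal))
    have hum := Lp.aestronglyMeasurable u
    set G : Z → ℝ := fun z => |F z (u z + 1) - F z (u z)| + |F z (u z - 1) - F z (u z)| with hG
    set δ : Z → ℝ := fun z => f z (u z) - v z with hδ
    -- The damping gives `k G ≤ w`, which keeps `F(u ± e)` below the integrable `F(u) + w`. It also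
    -- gives `k ≤ w` and `k ≤ 1`, hence `e² ≤ w` and `e ∈ L²`.
    set k : Z → ℝ := fun z => min (w z : ℝ) 1 / (1 + G z) with hk
    -- A bounded multiple of the defect with its sign: `δ e ≥ 0`, and it vanishes only where `δ`
    -- does.
    set e : Z → ℝ := fun z => δ z / (1 + |δ z|) * k z with he
    have hGm : AEStronglyMeasurable G μ := by
      have h1 := (h.aestronglyMeasurable (hum.add (aestronglyMeasurable_const (b := 1)))).sub
        (h.aestronglyMeasurable hum)
      have h2 := (h.aestronglyMeasurable (hum.sub (aestronglyMeasurable_const (b := 1)))).sub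
        (h.aestronglyMeasurable hum)
      exact h1.norm.add h2.norm
    have hδm : AEStronglyMeasurable δ μ :=
      (h.aestronglyMeasurable_deriv hum).sub (Lp.aestronglyMeasurable v)
    have hem : AEStronglyMeasurable e μ := by
      have h1 : AEMeasurable (fun z => min (w z : ℝ) 1) μ :=
        (hwm.coe_nnreal_real.min measurable_const).aemeasurable
      have h2 : AEMeasurable (fun z => |δ z|) μ := hδm.norm.aemeasurable
      exact ((hδm.aemeasurable.div (h2.const_add 1)).mul
        (h1.div (hGm.aemeasurable.const_add 1))).aestronglyMeasurable
    have hG0 : ∀ z, 0 ≤ G z := fun z => by positivity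
    have hk0 : ∀ z, 0 < k z := fun z =>
      div_pos (lt_min (by exact_mod_cast hwpos z) one_pos) (by linarith [hG0 z])
    have hek : ∀ z, |e z| ≤ k z := by
      intro z
      have h1 : |δ z| / (1 + |δ z|) ≤ 1 := (div_le_one (by positivity)).2 (by linarith)
      have h2 : |e z| = |δ z| / (1 + |δ z|) * k z := by
        rw [he, abs_mul, abs_div, abs_of_pos (hk0 z), abs_of_pos (show 0 < 1 + |δ z| by positivity)]
      rw [h2]
      exact mul_le_of_le_one_left (hk0 z).le h1
    have hkw : ∀ z, k z * (1 + G z) = min (w z : ℝ) 1 := fun z =>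
      div_mul_cancel₀ _ (by linarith [hG0 z])
    have hkG : ∀ z, k z * G z ≤ w z ∧ k z ≤ w z ∧ k z ≤ 1 := by
      intro z
      have h1 := hkw z
      have h2 := min_le_left (w z : ℝ) 1
      have h3 := min_le_right (w z : ℝ) 1
      have h4 := mul_nonneg (hk0 z).le (hG0 z)
      have h5 := hk0 z
      refine ⟨?_, ?_, ?_⟩ <;> linarith
    have hwI : Integrable (fun z => (w z : ℝ)) μ := by
      refine ⟨hwm.coe_nnreal_real.aestronglyMeasurable, ?_⟩
      rw [hasFiniteIntegral_iff_ofReal (f := fun z => (w z : ℝ)) (.of_forall fun z => (w z).2)]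
      simpa using hwi.trans ENNReal.one_lt_top
    have heL : MemLp e 2 μ := by
      refine (memLp_two_iff_integrable_sq hem).2 (hwI.mono' (hem.pow 2) (.of_forall fun z => ?_))
      rw [Real.norm_of_nonneg (sq_nonneg _), ← sq_abs]
      have h1 := hek z
      have h2 := abs_nonneg (e z)
      nlinarith [(hkG z).2.1, (hkG z).2.2]
    have hcoe : ∀ᵐ z ∂μ, heL.toLp e z = e z := heL.coeFn_toLp
    have hbound : ∀ z, Monotone (f z) → (∀ w, HasDerivAt (F z) (f z w) w) → ∀ s : ℝ, |s| ≤ k z →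
        F z (u z + s) ≤ F z (u z) + w z := by
      intro z hm hd s hs
      obtain ⟨c1, -, c3⟩ := hkG z
      have := le_add_abs_mul hm hd (u z) 1 (hs.trans c3)
      rw [mul_one] at this
      exact this.trans (add_le_add_right ((mul_le_mul_of_nonneg_right hs (hG0 z)).trans c1) _)
    have hmem : ∀ s : ℝ, |s| = 1 → Integrable (fun z => F z (u z + s * heL.toLp e z)) μ := by
      intro s hs
      have e1 : (fun z => F z ((u + s • heL.toLp e : Lp ℝ 2 μ) z)) =ᵐ[μ]
          fun z => F z (u z + s * heL.toLp e z) := by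
        filter_upwards [Lp.coeFn_add u (s • heL.toLp e), Lp.coeFn_smul s (heL.toLp e)] with z h1 h2
        rw [h1, Pi.add_apply, h2]; rfl
      refine (h.integrable_of_le _ (h0.add hwI) ?_).congr e1
      filter_upwards [e1, h.mono, h.deriv, hcoe] with z h1 hm hd h2
      rw [h1]
      refine hbound z hm hd _ ?_
      rw [abs_mul, hs, one_mul, h2]
      exact hek z
    obtain ⟨hI, hE⟩ := h.integral_deriv_eq_inner _ (e := heL.toLp e) hv
      (by simpa using hmem 1 (by simp)) (by simpa [sub_eq_add_neg] using hmem (-1) (by simp))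
    simp only [ContinuousLinearMap.id_apply] at hI hE
    rw [L2_inner_eq_integral_mul, ← sub_eq_zero, ← integral_sub hI (L2_integrable_mul _ _)] at hE
    have hprod : ∀ z, δ z * e z = δ z ^ 2 / (1 + |δ z|) * k z := fun z => by
      simp only [he]; ring
    have hnn : 0 ≤ᵐ[μ] fun z => f z (u z) * heL.toLp e z - v z * heL.toLp e z := by
      filter_upwards [hcoe] with z hz
      rw [← sub_mul, hz]
      change 0 ≤ δ z * e z
      rw [hprod]
      have := (hk0 z).le
      positivity
    rw [integral_eq_zero_iff_of_nonneg_ae hnn (hI.sub (L2_integrable_mul _ _))] at hE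
    filter_upwards [hE, hcoe] with z hz h1
    rw [← sub_mul, h1] at hz
    change δ z * e z = 0 at hz
    rw [hprod, mul_eq_zero, div_eq_zero_iff, or_iff_left (hk0 z).ne',
      or_iff_left (by positivity), sq_eq_zero_iff, sub_eq_zero] at hz
    exact hz.symm
  · intro hv
    have e1 : ∀ e : Lp ℝ 2 μ, (fun z => f z (u z) * e z) =ᵐ[μ] fun z => v z * e z := by
      intro e
      filter_upwards [hv] with z hz
      rw [hz]
    refine h.mem_subdifferential_of_integral_eq (.id ℝ _) (fun e => ?_) fun e => ?_
    · exact (L2_integrable_mul v e).congr (e1 e).symm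
    · rw [L2_inner_eq_integral_mul]
      exact integral_congr_ae (e1 e)

end General

end IsConvexIntegrand

/-! ### Finite expansions -/

variable {d r : ℕ} {Ω : TopologicalSpace.Opens (Sp d)}

lemma coeFn_expandX (ζ : Fin r → L2X Ω) (b : EuclideanSpace ℝ (Fin r)) :
    expandX ζ b =ᵐ[muX Ω] fun x => ∑ i, b i * ζ i x := by
  rw [expandX_apply]
  filter_upwards [Lp.coeFn_finsetSum Finset.univ (fun i => b i • ζ i),
    ae_all_iff.2 fun i => Lp.coeFn_smul (b i) (ζ i)] with x h1 h2
  rw [h1, Finset.sum_apply]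
  exact Finset.sum_congr rfl fun i _ => h2 i

lemma ae_ae_of_ae_muQ {p : Sp d × ℝ → Prop} (h : ∀ᵐ z ∂(muQ Ω), p z) :
    ∀ᵐ t ∂muT, ∀ᵐ x ∂(muX Ω), p (x, t) :=
  Measure.ae_ae_of_ae_prod (Measure.measurePreserving_swap.quasiMeasurePreserving.ae h)

lemma expandX_single (ζ : Fin r → L2X Ω) (i : Fin r) :
    expandX ζ (EuclideanSpace.single i 1) = ζ i := by
  classical
  rw [expandX_apply]
  simp

/-- Lets the results on spatial expansions be used at almost every fixed time. -/
lemma expandT_slice (ζ : Fin r → L2X Ω) (c : L2T r) :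
    ∀ᵐ t ∂muT, ∀ᵐ x ∂(muX Ω), expandT ζ c (x, t) = expandX ζ (c t) x := by
  filter_upwards [ae_ae_of_ae_muQ (expandT_apply ζ c)] with t ht
  filter_upwards [ht, coeFn_expandX ζ (c t)] with x h1 h2
  rw [h1, h2]

namespace IsConvexIntegrand

section Space

variable {F f : Sp d → ℝ → ℝ} {ζ : Fin r → L2X Ω}

/-- Convergence of the integrals against each `ζ_i` extends by linearity to every direction in the
span. No damping is therefore needed for spatial expansions. -/
lemma integrable_deriv_mul_expandX
    (hi : ∀ (c : Fin r → ℝ) (i : Fin r),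
      Integrable (fun x => f x (∑ p, c p * ζ p x) * ζ i x) (muX Ω))
    (c e : EuclideanSpace ℝ (Fin r)) :
    Integrable (fun x => f x (expandX ζ c x) * expandX ζ e x) (muX Ω) ∧
      ∫ x, f x (expandX ζ c x) * expandX ζ e x ∂(muX Ω) =
        ∑ i, e i * ∫ x, f x (∑ p, c p * ζ p x) * ζ i x ∂(muX Ω) := by
  have e1 : (fun x => f x (expandX ζ c x) * expandX ζ e x) =ᵐ[muX Ω]
      fun x => ∑ i, e i * (f x (∑ p, c p * ζ p x) * ζ i x) := by
    filter_upwards [coeFn_expandX ζ c, coeFn_expandX ζ e] with x h1 h2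
    rw [h1, h2, Finset.mul_sum]
    exact Finset.sum_congr rfl fun i _ => by ring
  refine ⟨(integrable_finsetSum _ fun i _ => (hi c i).const_mul _).congr e1.symm, ?_⟩
  rw [integral_congr_ae e1, integral_finsetSum _ fun i _ => (hi c i).const_mul _]
  simp_rw [integral_const_mul]

lemma integrable_expandX (h : IsConvexIntegrand (muX Ω) F f)
    (hi : ∀ (c : Fin r → ℝ) (i : Fin r),
      Integrable (fun x => f x (∑ p, c p * ζ p x) * ζ i x) (muX Ω))
    (c : EuclideanSpace ℝ (Fin r)) : Integrable (fun x => F x (expandX ζ c x)) (muX Ω) :=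
  h.integrable_of_integrable_mul _ (integrable_deriv_mul_expandX hi c c).1

/-- The subdifferential of an integral functional on a finite expansion. -/
theorem mem_subdifferential_expandX_iff (h : IsConvexIntegrand (muX Ω) F f)
    (hi : ∀ (c : Fin r → ℝ) (i : Fin r),
      Integrable (fun x => f x (∑ p, c p * ζ p x) * ζ i x) (muX Ω))
    {c a : EuclideanSpace ℝ (Fin r)} :
    a ∈ subdifferential (functional (muX Ω) F (expandX ζ)) c ↔
      ∀ i, a i = ∫ x, f x (∑ p, c p * ζ p x) * ζ i x ∂(muX Ω) := by
  constructor
  · intro ha i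
    have hs : ∀ s : ℝ, Integrable
        (fun x => F x (expandX ζ c x + s * expandX ζ (EuclideanSpace.single i 1) x)) (muX Ω) := by
      intro s
      refine (h.integrable_expandX hi (c + s • EuclideanSpace.single i 1)).congr ?_
      rw [map_add, map_smul]
      filter_upwards [Lp.coeFn_add (expandX ζ c) (s • expandX ζ (EuclideanSpace.single i 1)),
        Lp.coeFn_smul s (expandX ζ (EuclideanSpace.single i 1))] with x h1 h2
      rw [h1, Pi.add_apply, h2]; rfl
    have h1 := (h.integral_deriv_eq_inner _ ha (e := EuclideanSpace.single i 1)
      (by simpa using hs 1) (by simpa [sub_eq_add_neg] using hs (-1))).2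
    rw [(integrable_deriv_mul_expandX hi c _).2] at h1
    classical
    simpa [Finset.sum_ite_eq, EuclideanSpace.inner_single_right, eq_comm] using h1
  · intro ha
    refine h.mem_subdifferential_of_integral_eq _
      (fun e => (integrable_deriv_mul_expandX hi c e).1) fun e => ?_
    rw [(integrable_deriv_mul_expandX hi c e).2, PiLp.inner_apply]
    refine Finset.sum_congr rfl fun i _ => ?_
    rw [← ha i]
    simp

end Space

end IsConvexIntegrand

/-! ### Expansions with time-dependent coefficients -/

lemma aestronglyMeasurable_integral_space {g : Sp d × ℝ → ℝ}
    (hg : AEStronglyMeasurable g (muQ Ω)) :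
    AEStronglyMeasurable (fun t => ∫ x, g (x, t) ∂(muX Ω)) muT :=
  hg.prod_swap.integral_prod_right'

/-- The element `κ(t) e_i` of `L²((0,1); ℝ^r)`. -/
lemma memLp_smul_single {κ : ℝ → ℝ} (hκ : AEStronglyMeasurable κ muT) (hb : ∀ t, |κ t| ≤ 1)
    (i : Fin r) : MemLp (fun t => κ t • EuclideanSpace.single i (1 : ℝ)) 2 muT := by
  refine MemLp.of_bound (hκ.smul aestronglyMeasurable_const) 1 (.of_forall fun t => ?_)
  rw [norm_smul, PiLp.norm_single, norm_one, mul_one]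
  exact hb t

lemma expandT_smul_single (ζ : Fin r → L2X Ω) {κ : ℝ → ℝ} {i : Fin r}
    (h : MemLp (fun t => κ t • EuclideanSpace.single i (1 : ℝ)) 2 muT) :
    expandT ζ (h.toLp _) =ᵐ[muQ Ω] fun z => κ z.2 * ζ i z.1 := by
  have e := (Measure.quasiMeasurePreserving_snd (μ := muX Ω) (ν := muT)).ae h.coeFn_toLp
  filter_upwards [expandT_apply ζ (h.toLp _), e] with z h1 h2
  rw [h1, h2]
  classical
  simp

lemma inner_smul_single {κ : ℝ → ℝ} {i : Fin r}
    (h : MemLp (fun t => κ t • EuclideanSpace.single i (1 : ℝ)) 2 muT) (a : L2T r) :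
    Integrable (fun t => κ t * a t i) muT ∧ inner ℝ a (h.toLp _) = ∫ t, κ t * a t i ∂muT := by
  have e : (fun t => inner ℝ (a t) (h.toLp _ t)) =ᵐ[muT] fun t => κ t * a t i := by
    filter_upwards [h.coeFn_toLp] with t ht
    rw [ht, inner_smul_right, EuclideanSpace.inner_single_right]
    simp
  exact ⟨(L2.integrable_inner a (h.toLp _)).congr e, by rw [L2.inner_def, integral_congr_ae e]⟩

namespace IsConvexIntegrand

variable {F f : Sp d × ℝ → ℝ → ℝ} {ζ : Fin r → L2X Ω}

lemma slice (h : IsConvexIntegrand (muQ Ω) F f) :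
    ∀ᵐ t ∂muT, IsConvexIntegrand (muX Ω) (fun x => F (x, t)) (fun x => f (x, t)) := by
  have hm : AEStronglyMeasurable (fun z => f z 0) (muQ Ω) := h.memLp_zero.aestronglyMeasurable
  filter_upwards [ae_ae_of_ae_muQ h.mono, ae_ae_of_ae_muQ h.deriv,
    h.memLp_zero.integrable_sq.prod_left_ae, h.integrable_zero.prod_left_ae] with t h1 h2 h3 h4
  refine ⟨h.meas.comp ((measurable_fst.prodMk measurable_const).prodMk measurable_snd), h1, h2,
    (memLp_two_iff_integrable_sq ?_).2 h3, h4⟩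
  exact (h.meas.comp ((measurable_id.prodMk measurable_const).prodMk
    measurable_const)).aestronglyMeasurable

/-- Finiteness on each slice does not control the integral in time. The slicewise subgradient does:
tested at zero, it bounds the energy of the slice by `∫ F(·,t,0) + ⟨a(t),c(t)⟩`, which is integrable
in `t`. -/
lemma integrable_expandT (h : IsConvexIntegrand (muQ Ω) F f)
    (hi : ∀ᵐ t ∂muT, ∀ (c : Fin r → ℝ) (i : Fin r),
      Integrable (fun x => f (x, t) (∑ p, c p * ζ p x) * ζ i x) (muX Ω)) {c a : L2T r}
    (ha : ∀ᵐ t ∂muT, a t ∈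
      subdifferential (functional (muX Ω) (fun x => F (x, t)) (expandX ζ)) (c t)) :
    Integrable (fun z => F z (expandT ζ c z)) (muQ Ω) := by
  set u := expandT ζ c
  set B : Sp d × ℝ → ℝ := fun z => F z (u z) - (F z 0 + f z 0 * u z) with hB
  have hmin := h.integrable_minorant u
  have hBm : AEStronglyMeasurable B (muQ Ω) :=
    (h.aestronglyMeasurable (Lp.aestronglyMeasurable u)).sub hmin.aestronglyMeasurable
  have hR : Integrable (fun t => (∫ x, F (x, t) 0 ∂(muX Ω)) + inner ℝ (a t) (c t) -
      ∫ x, (F (x, t) 0 + f (x, t) 0 * u (x, t)) ∂(muX Ω)) muT :=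
    (h.integrable_zero.integral_prod_right.add (L2.integrable_inner a c)).sub
      hmin.integral_prod_right
  have hBi : Integrable B (muQ Ω) := by
    have hslice : ∀ᵐ t ∂muT, Integrable (fun x => F (x, t) (u (x, t))) (muX Ω) := by
      filter_upwards [hi, h.slice, expandT_slice ζ c] with t h1 h2 h3
      refine (h2.integrable_expandX h1 (c t)).congr ?_
      filter_upwards [h3] with x hx
      rw [hx]
    -- Above its tangent at zero the integrand is nonnegative, so its `L¹` norm on a slice is its
    -- integral and Tonelli's theorem applies.
    refine (integrable_prod_iff' hBm).2 ⟨?_, hR.mono' ?_ ?_⟩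
    · filter_upwards [hslice, hmin.prod_left_ae] with t h1 h2 using h1.sub h2
    · exact aestronglyMeasurable_integral_space hBm.norm
    · filter_upwards [hslice, hmin.prod_left_ae, ae_ae_of_ae_muQ h.bregman_nonneg, ha,
        expandT_slice ζ c, h.slice] with t h1 h2 h3 h4 h5 h6
      rw [Real.norm_of_nonneg (integral_nonneg fun _ => norm_nonneg _)]
      have e1 : ∫ x, ‖B (x, t)‖ ∂(muX Ω) = ∫ x, B (x, t) ∂(muX Ω) := by
        refine integral_congr_ae ?_
        filter_upwards [h3] with x hx
        rw [Real.norm_of_nonneg]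
        have := hx (u (x, t))
        simp only [hB]
        linarith
      have e2 : ∫ x, B (x, t) ∂(muX Ω) = (∫ x, F (x, t) (u (x, t)) ∂(muX Ω)) -
          ∫ x, (F (x, t) 0 + f (x, t) 0 * u (x, t)) ∂(muX Ω) := integral_sub h1 h2
      have e3 : ∫ x, F (x, t) (expandX ζ (c t) x) ∂(muX Ω) = ∫ x, F (x, t) (u (x, t)) ∂(muX Ω) := by
        refine integral_congr_ae ?_
        filter_upwards [h5] with x hx
        rw [hx]
      have e4 : (fun x => F (x, t) (expandX ζ 0 x)) =ᵐ[muX Ω] fun x => F (x, t) 0 := by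
        rw [map_zero]
        filter_upwards [Lp.coeFn_zero ℝ 2 (muX Ω)] with x hx
        rw [hx, Pi.zero_apply]
      have h7 := ((mem_subdifferential_iff _ _).1 h4).2 0 (h6.integrable_zero.congr e4.symm)
      rw [e3, integral_congr_ae e4, zero_sub, inner_neg_right] at h7
      rw [e1, e2]
      linarith
  refine (hBi.add hmin).congr (.of_forall fun z => ?_)
  simp [hB]

/-- The slicewise subgradient inequalities are integrated in time; `integrable_expandT` shows that
the value at `c` is finite. -/
lemma mem_subdifferential_expandT (h : IsConvexIntegrand (muQ Ω) F f)
    (hi : ∀ᵐ t ∂muT, ∀ (c : Fin r → ℝ) (i : Fin r),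
      Integrable (fun x => f (x, t) (∑ p, c p * ζ p x) * ζ i x) (muX Ω)) {c a : L2T r}
    (ha : ∀ᵐ t ∂muT, a t ∈
      subdifferential (functional (muX Ω) (fun x => F (x, t)) (expandX ζ)) (c t)) :
    a ∈ subdifferential (functional (muQ Ω) F (expandT ζ)) c := by
  have h0 := h.integrable_expandT hi ha
  refine (mem_subdifferential_iff _ _).2 ⟨h0, fun y hy => ?_⟩
  rw [integral_prod_symm _ h0, integral_prod_symm _ hy, L2.inner_def,
    ← integral_add h0.integral_prod_right (L2.integrable_inner _ _)]
  refine integral_mono_ae (h0.integral_prod_right.add (L2.integrable_inner _ _))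
    hy.integral_prod_right ?_
  filter_upwards [ha, expandT_slice ζ c, expandT_slice ζ y, Lp.coeFn_sub y c, h.slice, hi]
    with t h1 h2 h3 h4 h5 h6
  have e : ∀ w : L2T r, (∀ᵐ x ∂(muX Ω), expandT ζ w (x, t) = expandX ζ (w t) x) →
      ∫ x, F (x, t) (expandT ζ w (x, t)) ∂(muX Ω) =
        ∫ x, F (x, t) (expandX ζ (w t) x) ∂(muX Ω) := by
    intro w hw
    refine integral_congr_ae ?_
    filter_upwards [hw] with x hx
    rw [hx]
  rw [e c h2, e y h3, h4]
  exact ((mem_subdifferential_iff _ _).1 h1).2 _ (h5.integrable_expandX h6 (y t))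

/-- A subgradient is tested against `κ(t) e_i`, with `κ` carrying the sign of the defect of the
`i`-th coefficient. The directions available are constrained in `x`, so the damping acts in `t`
alone and uses integrals over slices. -/
lemma coeff_eq_of_mem_subdifferential_expandT (h : IsConvexIntegrand (muQ Ω) F f)
    (hi : ∀ᵐ t ∂muT, ∀ (c : Fin r → ℝ) (i : Fin r),
      Integrable (fun x => f (x, t) (∑ p, c p * ζ p x) * ζ i x) (muX Ω)) {c a : L2T r}
    (ha : a ∈ subdifferential (functional (muQ Ω) F (expandT ζ)) c) (i : Fin r) :
    ∀ᵐ t ∂muT, a t i = ∫ x, f (x, t) (expandT ζ c (x, t)) * ζ i x ∂(muX Ω) := by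
  obtain ⟨h0, -⟩ := (mem_subdifferential_iff _ _).1 ha
  set u := expandT ζ c with hu
  have hum := Lp.aestronglyMeasurable u
  have hζm : AEStronglyMeasurable (fun z : Sp d × ℝ => ζ i z.1) (muQ Ω) :=
    (Lp.aestronglyMeasurable (ζ i)).comp_quasiMeasurePreserving
      Measure.quasiMeasurePreserving_fst
  set H : Sp d × ℝ → ℝ := fun z =>
    |F z (u z + ζ i z.1) - F z (u z)| + |F z (u z - ζ i z.1) - F z (u z)| with hH
  have hHm : AEStronglyMeasurable H (muQ Ω) := by
    have h1 := (h.aestronglyMeasurable (hum.add hζm)).sub (h.aestronglyMeasurable hum)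
    have h2 := (h.aestronglyMeasurable (hum.sub hζm)).sub (h.aestronglyMeasurable hum)
    exact h1.norm.add h2.norm
  have hH0 : ∀ z, 0 ≤ H z := fun z => by positivity
  have hHi : ∀ᵐ t ∂muT, Integrable (fun x => H (x, t)) (muX Ω) := by
    filter_upwards [hi, h.slice, expandT_slice ζ c] with t h1 h2 h3
    have hs : ∀ s : ℝ, Integrable (fun x => F (x, t) (u (x, t) + s * ζ i x)) (muX Ω) := by
      intro s
      refine (h2.integrable_expandX h1 (c t + s • EuclideanSpace.single i 1)).congr ?_
      rw [map_add, map_smul, expandX_single]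
      filter_upwards [Lp.coeFn_add (expandX ζ (c t)) (s • ζ i), Lp.coeFn_smul s (ζ i), h3]
        with x e1 e2 e3
      rw [e1, Pi.add_apply, e2, hu, e3]; rfl
    have s0 := hs 0
    have s1 := hs 1
    have s2 := hs (-1)
    simp only [zero_mul, add_zero, one_mul, neg_mul, ← sub_eq_add_neg] at s0 s1 s2
    exact (s1.sub s0).abs.add (s2.sub s0).abs
  set G : ℝ → ℝ := fun t => ∫ x, H (x, t) ∂(muX Ω)
  have hGm : AEStronglyMeasurable G muT := aestronglyMeasurable_integral_space hHm
  have hG0 : ∀ t, 0 ≤ G t := fun t => integral_nonneg fun x => hH0 _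
  set δ : ℝ → ℝ := fun t => (∫ x, f (x, t) (u (x, t)) * ζ i x ∂(muX Ω)) - a t i with hδ
  have hδm : AEStronglyMeasurable δ muT := by
    refine (aestronglyMeasurable_integral_space
      (g := fun z => f z (u z) * ζ i z.1) ((h.aestronglyMeasurable_deriv hum).mul hζm)).sub ?_
    exact (EuclideanSpace.proj i : EuclideanSpace ℝ (Fin r) →L[ℝ] ℝ).continuous.comp_aestronglyMeasurable
      (Lp.aestronglyMeasurable a)
  -- This choice gives `|κ| ≤ 1` and `|κ| G ≤ 1`. As `(0,1)` has finite measure, no further weight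
  -- is needed for `|κ| H` to be integrable on `Q`.
  set κ : ℝ → ℝ := fun t => δ t / (1 + |δ t|) / (1 + G t) with hκ
  have hκm : AEStronglyMeasurable κ muT := by
    have h2 : AEMeasurable (fun t => |δ t|) muT := hδm.norm.aemeasurable
    exact ((hδm.aemeasurable.div (h2.const_add 1)).div
      (hGm.aemeasurable.const_add 1)).aestronglyMeasurable
  have hκG : ∀ t, |κ t| * (1 + G t) ≤ 1 := by
    intro t
    have h3 : 0 < 1 + G t := by linarith [hG0 t]
    rw [hκ, abs_div, abs_div, abs_of_pos h3, div_mul_cancel₀ _ h3.ne',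
      abs_of_pos (show 0 < 1 + |δ t| by positivity)]
    exact (div_le_one (by positivity)).2 (by linarith)
  have hκ1 : ∀ t, |κ t| ≤ 1 := fun t => by
    nlinarith [hκG t, mul_nonneg (abs_nonneg (κ t)) (hG0 t)]
  have heL := memLp_smul_single hκm hκ1 i
  have hκm' : AEStronglyMeasurable (fun z : Sp d × ℝ => κ z.2) (muQ Ω) :=
    hκm.comp_quasiMeasurePreserving Measure.quasiMeasurePreserving_snd
  have hκH : Integrable (fun z => |κ z.2| * H z) (muQ Ω) := by
    have hm : AEStronglyMeasurable (fun z => |κ z.2| * H z) (muQ Ω) := hκm'.norm.mul hHm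
    refine (integrable_prod_iff' hm).2 ⟨?_, ?_⟩
    · filter_upwards [hHi] with t ht using ht.const_mul _
    · refine Integrable.of_bound
        (aestronglyMeasurable_integral_space hm.norm) 1 (.of_forall fun t => ?_)
      rw [Real.norm_of_nonneg (integral_nonneg fun _ => norm_nonneg _)]
      have e1 : ∀ x, ‖|κ t| * H (x, t)‖ = |κ t| * H (x, t) := fun x =>
        Real.norm_of_nonneg (mul_nonneg (abs_nonneg _) (hH0 _))
      simp only [e1]
      rw [integral_const_mul]
      have := hκG t
      have h4 := abs_nonneg (κ t)
      change |κ t| * G t ≤ 1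
      linarith
  have hcoe := expandT_smul_single ζ heL
  have hmem : ∀ s : ℝ, |s| = 1 →
      Integrable (fun z => F z (u z + s * expandT ζ (heL.toLp _) z)) (muQ Ω) := by
    intro s hs
    set w := expandT ζ (heL.toLp _)
    have e1 : (fun z => F z ((u + s • w : L2Q Ω) z)) =ᵐ[muQ Ω] fun z => F z (u z + s * w z) := by
      filter_upwards [Lp.coeFn_add u (s • w), Lp.coeFn_smul s w] with z h1 h2
      rw [h1, Pi.add_apply, h2]; rfl
    refine (h.integrable_of_le _ (h0.add hκH) ?_).congr e1
    filter_upwards [e1, h.mono, h.deriv, hcoe] with z h1 hm hd h2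
    rw [h1, h2, ← mul_assoc]
    have h3 : |s * κ z.2| = |κ z.2| := by rw [abs_mul, hs, one_mul]
    have := le_add_abs_mul hm hd (u z) (ζ i z.1) (h3.trans_le (hκ1 _))
    rwa [h3] at this
  obtain ⟨hI, hE⟩ := h.integral_deriv_eq_inner _ (e := heL.toLp _) ha
    (by simpa using hmem 1 (by simp)) (by simpa [sub_eq_add_neg] using hmem (-1) (by simp))
  obtain ⟨hJ, hJ2⟩ := inner_smul_single heL a
  have hslice : ∀ᵐ t ∂muT, ∫ x, f (x, t) (u (x, t)) * expandT ζ (heL.toLp _) (x, t) ∂(muX Ω) =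
      κ t * ∫ x, f (x, t) (u (x, t)) * ζ i x ∂(muX Ω) := by
    filter_upwards [ae_ae_of_ae_muQ hcoe] with t ht
    rw [← integral_const_mul]
    refine integral_congr_ae ?_
    filter_upwards [ht] with x hx
    rw [hx]; ring
  have hI2 := hI.integral_prod_right.congr hslice
  rw [integral_prod_symm _ hI, integral_congr_ae hslice, hJ2, ← sub_eq_zero,
    ← integral_sub hI2 hJ] at hE
  have hprod : ∀ t, κ t * (∫ x, f (x, t) (u (x, t)) * ζ i x ∂(muX Ω)) - κ t * a t i =
      δ t ^ 2 / (1 + |δ t|) / (1 + G t) := by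
    intro t
    rw [← mul_sub]
    change κ t * δ t = _
    simp only [hκ]
    ring
  simp_rw [hprod] at hE
  rw [integral_eq_zero_iff_of_nonneg (fun t => ?_)
    ((hI2.sub hJ).congr (.of_forall hprod))] at hE
  · filter_upwards [hE] with t ht
    rw [Pi.zero_apply, div_eq_zero_iff, or_iff_left (by linarith [hG0 t]), div_eq_zero_iff,
      or_iff_left (by positivity), sq_eq_zero_iff, sub_eq_zero] at ht
    exact ht.symm
  · have := hG0 t
    simp only [Pi.zero_apply]
    positivity

/-- The subdifferential of an integral functional on finite expansions with coefficients depending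
on time. -/
theorem mem_subdifferential_expandT_iff (h : IsConvexIntegrand (muQ Ω) F f)
    (hi : ∀ᵐ t ∂muT, ∀ (c : Fin r → ℝ) (i : Fin r),
      Integrable (fun x => f (x, t) (∑ p, c p * ζ p x) * ζ i x) (muX Ω)) {c a : L2T r} :
    a ∈ subdifferential (functional (muQ Ω) F (expandT ζ)) c ↔
      ∀ i, ∀ᵐ t ∂muT, a t i = ∫ x, f (x, t) (∑ p, c t p * ζ p x) * ζ i x ∂(muX Ω) := by
  constructor
  · intro ha i
    filter_upwards [h.coeff_eq_of_mem_subdifferential_expandT hi ha i,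
      ae_ae_of_ae_muQ (expandT_apply ζ c)] with t h1 h2
    rw [h1]
    refine integral_congr_ae ?_
    filter_upwards [h2] with x hx
    rw [hx]
  · intro ha
    refine h.mem_subdifferential_expandT hi ?_
    filter_upwards [ae_all_iff.2 ha, h.slice, hi] with t h1 h2 h3
    exact (h2.mem_subdifferential_expandX_iff h3).2 h1

end IsConvexIntegrand

/-! ### The adjoint of `C` -/

/-- The element `(a, b, α, β, φ)` of `PrimalSpace r Ω`. -/
def PrimalSpace.mk (a : L2T r) (b : EuclideanSpace ℝ (Fin r)) (α : L2Q Ω) (β : L2X Ω)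
    (φ : H1 Ω) : PrimalSpace r Ω :=
  WithLp.toLp 2 (a, WithLp.toLp 2 (b, WithLp.toLp 2 (α, WithLp.toLp 2 (β, φ))))

lemma PrimalSpace.inner_mk (s : PrimalSpace r Ω) (a : L2T r) (b : EuclideanSpace ℝ (Fin r))
    (α : L2Q Ω) (β : L2X Ω) (φ : H1 Ω) : inner ℝ s (PrimalSpace.mk a b α β φ) =
      inner ℝ s.a a + (inner ℝ s.b b + (inner ℝ s.α α + (inner ℝ s.β β + inner ℝ s.φ φ))) := by
  simp only [WithLp.prod_inner_apply]
  rfl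

lemma DualSpace.inner_mk (ρ ρ' : L2Q Ω) (m m' : L2Qd Ω) (ρ₀ ρ₁ ρ₀' ρ₁' : L2X Ω) :
    inner ℝ (DualSpace.mk ρ m ρ₀ ρ₁) (DualSpace.mk ρ' m' ρ₀' ρ₁') =
      inner ℝ ρ ρ' + (inner ℝ m m' + (inner ℝ ρ₀ ρ₀' + inner ℝ ρ₁ ρ₁')) := by
  simp only [WithLp.prod_inner_apply]
  rfl

section Adjoint

variable (ζ : Fin r → L2X Ω) (ρ : L2Q Ω) (m : L2Qd Ω) (ρ₀ ρ₁ : L2X Ω)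

/-- Setting all but one of the five arguments to zero isolates each component of the adjoint. -/
lemma inner_adjoint_opC (a : L2T r) (b : EuclideanSpace ℝ (Fin r)) (α : L2Q Ω) (β : L2X Ω)
    (φ : H1 Ω) :
    inner ℝ ((opC ζ).adjoint (DualSpace.mk ρ m ρ₀ ρ₁)).a a +
      (inner ℝ ((opC ζ).adjoint (DualSpace.mk ρ m ρ₀ ρ₁)).b b +
        (inner ℝ ((opC ζ).adjoint (DualSpace.mk ρ m ρ₀ ρ₁)).α α +
          (inner ℝ ((opC ζ).adjoint (DualSpace.mk ρ m ρ₀ ρ₁)).β β +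
            inner ℝ ((opC ζ).adjoint (DualSpace.mk ρ m ρ₀ ρ₁)).φ φ))) =
      inner ℝ ρ (-expandT ζ a - α - φ.dt) + (inner ℝ m (-φ.grad) + (inner ℝ ρ₀ (-φ.tr0) +
        inner ℝ ρ₁ (-expandX ζ b - β + φ.tr1))) := by
  rw [← PrimalSpace.inner_mk, ContinuousLinearMap.adjoint_inner_left, opC_apply, DualSpace.inner_mk]
  rfl

lemma H1.dt_zero : (0 : H1 Ω).dt = 0 := rfl
lemma H1.grad_zero : (0 : H1 Ω).grad = 0 := rfl
lemma H1.tr0_zero : (0 : H1 Ω).tr0 = 0 := rfl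
lemma H1.tr1_zero : (0 : H1 Ω).tr1 = 0 := rfl

lemma adjoint_opC_a : ((opC ζ).adjoint (DualSpace.mk ρ m ρ₀ ρ₁)).a = -(expandT ζ).adjoint ρ := by
  refine ext_inner_right ℝ fun a => ?_
  have := inner_adjoint_opC ζ ρ m ρ₀ ρ₁ a 0 0 0 0
  simpa [H1.dt_zero, H1.grad_zero, H1.tr0_zero, H1.tr1_zero,
    ContinuousLinearMap.adjoint_inner_left] using this

lemma adjoint_opC_b : ((opC ζ).adjoint (DualSpace.mk ρ m ρ₀ ρ₁)).b = -(expandX ζ).adjoint ρ₁ := by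
  refine ext_inner_right ℝ fun b => ?_
  have := inner_adjoint_opC ζ ρ m ρ₀ ρ₁ 0 b 0 0 0
  simpa [H1.dt_zero, H1.grad_zero, H1.tr0_zero, H1.tr1_zero,
    ContinuousLinearMap.adjoint_inner_left] using this

lemma adjoint_opC_α : ((opC ζ).adjoint (DualSpace.mk ρ m ρ₀ ρ₁)).α = -ρ := by
  refine ext_inner_right ℝ fun α => ?_
  have := inner_adjoint_opC ζ ρ m ρ₀ ρ₁ 0 0 α 0 0
  simpa [H1.dt_zero, H1.grad_zero, H1.tr0_zero, H1.tr1_zero] using this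

lemma adjoint_opC_β : ((opC ζ).adjoint (DualSpace.mk ρ m ρ₀ ρ₁)).β = -ρ₁ := by
  refine ext_inner_right ℝ fun β => ?_
  have := inner_adjoint_opC ζ ρ m ρ₀ ρ₁ 0 0 0 β 0
  simpa [H1.dt_zero, H1.grad_zero, H1.tr0_zero, H1.tr1_zero] using this

lemma spaceTimeDiv_eq (φ : H1 Ω) : spaceTimeDiv ρ m ρ₀ ρ₁ φ =
    -(inner ℝ ρ φ.dt + inner ℝ m φ.grad) + inner ℝ ρ₁ φ.tr1 - inner ℝ ρ₀ φ.tr0 := by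
  rw [spaceTimeDiv, integral_add (L2_integrable_mul _ _) (L2.integrable_inner _ _),
    ← L2_inner_eq_integral_mul, ← L2_inner_eq_integral_mul, ← L2_inner_eq_integral_mul,
    ← L2.inner_def, real_inner_comm ρ, real_inner_comm m, real_inner_comm ρ₁, real_inner_comm ρ₀]

lemma inner_adjoint_opC_φ (φ : H1 Ω) :
    inner ℝ ((opC ζ).adjoint (DualSpace.mk ρ m ρ₀ ρ₁)).φ φ = spaceTimeDiv ρ m ρ₀ ρ₁ φ := by
  have := inner_adjoint_opC ζ ρ m ρ₀ ρ₁ 0 0 0 0 φ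
  simp only [inner_zero_right, map_zero, neg_zero, sub_zero, zero_sub,
    zero_add, inner_neg_right] at this
  rw [this, spaceTimeDiv_eq]
  ring

/-- With zero boundary data, moving the trace terms to the left completes the gradient integral to
the inner product of `H¹`. -/
lemma isRobinSolution_zero_iff (h : H1 Ω) (g : H1 Ω → ℝ) :
    IsRobinSolution h g 0 0 ↔ ∀ φ, inner ℝ h φ = -g φ := by
  refine forall_congr' fun φ => ?_
  have e : ∀ v w : L2X Ω, ∫ x, ((0 : L2X Ω) x - v x) * w x ∂(muX Ω) = -∫ x, v x * w x ∂(muX Ω) := by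
    intro v w
    rw [← integral_neg]
    refine integral_congr_ae ?_
    filter_upwards [Lp.coeFn_zero ℝ 2 (muX Ω)] with x hx
    rw [hx, Pi.zero_apply]; ring
  rw [e, e, H1.inner_eq, H1.form]
  constructor <;> intro h <;> linarith

/-- The coefficients of `ρ(·,t)` are the values of the adjoint of the expansion map. -/
lemma adjoint_expandT_apply (i : Fin r) :
    ∀ᵐ t ∂muT, (expandT ζ).adjoint ρ t i = ∫ x, ρ (x, t) * ζ i x ∂(muX Ω) := by
  have key : ∀ (κ : ℝ → ℝ), AEStronglyMeasurable κ muT → (∀ t, |κ t| ≤ 1) →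
      Integrable (fun t => κ t * (expandT ζ).adjoint ρ t i) muT ∧
      Integrable (fun t => κ t * ∫ x, ρ (x, t) * ζ i x ∂(muX Ω)) muT ∧
      ∫ t, κ t * (expandT ζ).adjoint ρ t i ∂muT =
        ∫ t, κ t * ∫ x, ρ (x, t) * ζ i x ∂(muX Ω) ∂muT := by
    intro κ hm hb
    have heL := memLp_smul_single hm hb i
    obtain ⟨h1, h2⟩ := inner_smul_single heL ((expandT ζ).adjoint ρ)
    have hI := L2_integrable_mul ρ (expandT ζ (heL.toLp _))
    have hslice : ∀ᵐ t ∂muT, ∫ x, ρ (x, t) * expandT ζ (heL.toLp _) (x, t) ∂(muX Ω) =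
        κ t * ∫ x, ρ (x, t) * ζ i x ∂(muX Ω) := by
      filter_upwards [ae_ae_of_ae_muQ (expandT_smul_single ζ heL)] with t ht
      rw [← integral_const_mul]
      refine integral_congr_ae ?_
      filter_upwards [ht] with x hx
      rw [hx]; ring
    refine ⟨h1, hI.integral_prod_right.congr hslice, ?_⟩
    rw [← h2, ContinuousLinearMap.adjoint_inner_left, L2_inner_eq_integral_mul,
      integral_prod_symm _ hI, integral_congr_ae hslice]
  -- The choice `κ = 1` gives integrability of both sides; indicators of measurable sets then
  -- identify them almost everywhere.
  obtain ⟨h1, h2, -⟩ := key 1 aestronglyMeasurable_const (by simp)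
  simp only [Pi.one_apply, one_mul] at h1 h2
  refine Integrable.ae_eq_of_forall_setIntegral_eq _ _ h1 h2 fun s hs _ => ?_
  obtain ⟨-, -, h3⟩ := key (s.indicator 1)
    ((measurable_one.indicator hs).aestronglyMeasurable) (fun t => by
      by_cases ht : t ∈ s <;> simp [ht])
  have e : ∀ (g : ℝ → ℝ), ∫ t, s.indicator 1 t * g t ∂muT = ∫ t in s, g t ∂muT := by
    intro g
    rw [← integral_indicator hs]
    refine integral_congr_ae (.of_forall fun t => ?_)
    by_cases ht : t ∈ s <;> simp [ht]
  rwa [e, e] at h3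

lemma adjoint_expandX_apply (i : Fin r) :
    (expandX ζ).adjoint ρ₁ i = ∫ x, ρ₁ x * ζ i x ∂(muX Ω) := by
  have h := ContinuousLinearMap.adjoint_inner_left (expandX ζ) (EuclideanSpace.single i 1) ρ₁
  rw [expandX_single, L2_inner_eq_integral_mul] at h
  rw [← h, EuclideanSpace.inner_single_right]
  simp

end Adjoint

/-! ### The projected kernel -/

lemma inner_tensor_tensor {α β : Type*} [MeasurableSpace α] [MeasurableSpace β] {μ : Measure α}
    {ν : Measure β} [SFinite μ] [SFinite ν] (f f' : Lp ℝ 2 μ) (g g' : Lp ℝ 2 ν) :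
    inner ℝ (tensor f g) (tensor f' g') = inner ℝ f f' * inner ℝ g g' := by
  rw [L2_inner_eq_integral_mul, L2_inner_eq_integral_mul, L2_inner_eq_integral_mul,
    ← integral_prod_mul]
  refine integral_congr_ae ?_
  filter_upwards [coeFn_tensor f g, coeFn_tensor f' g'] with z h1 h2
  rw [h1, h2]; ring

lemma kernelMatrix_apply (ζ : Fin r → L2X Ω) (K : Lp ℝ 2 ((muX Ω).prod (muX Ω))) (p q : Fin r) :
    kernelMatrix ζ K p q = inner ℝ (tensor (ζ p) (ζ q)) K := by
  rw [L2_inner_eq_integral_mul, kernelMatrix, Matrix.of_apply]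
  refine integral_congr_ae ?_
  filter_upwards [coeFn_tensor (ζ p) (ζ q)] with z h1
  rw [h1]; ring

/-- The tensors `ζ_i ⊗ ζ_j` inherit orthonormality from the `ζ_i`, and the entries of the matrix are
the Fourier coefficients of `K`. -/
lemma projKernel_eq {ζ : Fin r → L2X Ω} (hζ : Orthonormal ℝ ζ)
    (K : Lp ℝ 2 ((muX Ω).prod (muX Ω))) :
    projKernel ζ K = ∑ ij : Fin r × Fin r,
      kernelMatrix ζ K ij.1 ij.2 • tensor (ζ ij.1) (ζ ij.2) := by
  classical
  have : FiniteDimensional ℝ (Submodule.span ℝ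
      (range fun ij : Fin r × Fin r => tensor (ζ ij.1) (ζ ij.2))) :=
    FiniteDimensional.span_of_finite ℝ (finite_range _)
  rw [projKernel]
  refine Submodule.eq_starProjection_of_mem_of_inner_eq_zero ?_ fun w hw => ?_
  · exact Submodule.sum_mem _ fun ij _ => Submodule.smul_mem _ _ (Submodule.subset_span ⟨ij, rfl⟩)
  · induction hw using Submodule.span_induction with
    | mem x hx =>
      obtain ⟨pq, rfl⟩ := hx
      simp only [inner_sub_left, sum_inner, real_inner_smul_left, inner_tensor_tensor,
        orthonormal_iff_ite.1 hζ]
      rw [Finset.sum_eq_single pq]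
      · rw [kernelMatrix_apply, real_inner_comm]; simp
      · intro ij _ hne
        by_cases h1 : ij.1 = pq.1
        · have h2 : ij.2 ≠ pq.2 := fun h2 => hne (Prod.ext h1 h2)
          simp [h2]
        · simp [h1]
      · intro h; exact (h (Finset.mem_univ _)).elim
    | zero => exact inner_zero_right _
    | add x y _ _ hx hy => rw [inner_add_right, hx, hy, add_zero]
    | smul c x _ hx => rw [real_inner_smul_right, hx, mul_zero]

/-- The projected kernel acts on a function through its coefficients. -/
lemma integral_projKernel_mul {ζ : Fin r → L2X Ω} (hζ : Orthonormal ℝ ζ)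
    (K : Lp ℝ 2 ((muX Ω).prod (muX Ω))) :
    ∀ᵐ x ∂(muX Ω), ∀ g : Sp d → ℝ, (∀ q, Integrable (fun y => g y * ζ q y) (muX Ω)) →
      ∫ y, projKernel ζ K (x, y) * g y ∂(muX Ω) =
        ∑ p, (∑ q, kernelMatrix ζ K p q * ∫ y, g y * ζ q y ∂(muX Ω)) * ζ p x := by
  have h1 : ∀ᵐ z ∂((muX Ω).prod (muX Ω)), projKernel ζ K z =
      ∑ ij : Fin r × Fin r, kernelMatrix ζ K ij.1 ij.2 * (ζ ij.1 z.1 * ζ ij.2 z.2) := by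
    rw [projKernel_eq hζ]
    filter_upwards [Lp.coeFn_finsetSum Finset.univ (fun ij : Fin r × Fin r =>
        kernelMatrix ζ K ij.1 ij.2 • tensor (ζ ij.1) (ζ ij.2)),
      ae_all_iff.2 fun ij : Fin r × Fin r =>
        Lp.coeFn_smul (kernelMatrix ζ K ij.1 ij.2) (tensor (ζ ij.1) (ζ ij.2)),
      ae_all_iff.2 fun ij : Fin r × Fin r => coeFn_tensor (ζ ij.1) (ζ ij.2)] with z e1 e2 e3
    rw [e1, Finset.sum_apply]
    refine Finset.sum_congr rfl fun ij _ => ?_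
    rw [e2, Pi.smul_apply, e3, smul_eq_mul]
  -- The exceptional set of `x` comes from the kernel alone, so one null set serves all `g`, in
  -- particular all slices `ρ(·,t)`.
  filter_upwards [Measure.ae_ae_of_ae_prod h1] with x hx g hg
  have e1 : (fun y => projKernel ζ K (x, y) * g y) =ᵐ[muX Ω] fun y => ∑ ij : Fin r × Fin r,
      (kernelMatrix ζ K ij.1 ij.2 * ζ ij.1 x) * (g y * ζ ij.2 y) := by
    filter_upwards [hx] with y hy
    rw [hy, Finset.sum_mul]
    exact Finset.sum_congr rfl fun ij _ => by ring
  rw [integral_congr_ae e1, integral_finsetSum _ fun ij _ => (hg ij.2).const_mul _,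
    Fintype.sum_prod_type]
  refine Finset.sum_congr rfl fun p _ => ?_
  rw [Finset.sum_mul]
  refine Finset.sum_congr rfl fun q _ => ?_
  rw [integral_const_mul]; ring

/-! ### From the couplings to convex integrands -/

lemma ae_mem_muX : ∀ᵐ x ∂(muX Ω), x ∈ Ω :=
  ae_restrict_mem Ω.isOpen.measurableSet

lemma ae_mem_muQ : ∀ᵐ z ∂(muQ Ω), z.1 ∈ Ω ∧ z.2 ∈ Ioo (0 : ℝ) 1 := by
  filter_upwards [Measure.quasiMeasurePreserving_fst.ae (ae_mem_muX (Ω := Ω)),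
    Measure.quasiMeasurePreserving_snd.ae (ae_restrict_mem measurableSet_Ioo)] with z h1 h2
  exact ⟨h1, h2⟩

lemma isConvexIntegrand_muX {F f : Sp d → ℝ → ℝ}
    (hfm : Measurable fun p : Sp d × ℝ => f p.1 p.2) (hf : ∀ x ∈ Ω, Monotone (f x))
    (hF : ∀ x ∈ Ω, ∀ z, HasDerivAt (F x) (f x z) z) (hfz : MemLp (fun x => f x 0) 2 (muX Ω))
    (hFz : Integrable (fun x => F x 0) (muX Ω)) : IsConvexIntegrand (muX Ω) F f where
  meas := hfm
  mono := ae_mem_muX.mono hf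
  deriv := ae_mem_muX.mono hF
  memLp_zero := hfz
  integrable_zero := hFz

lemma isConvexIntegrand_muQ {F f : ℝ → Sp d → ℝ → ℝ}
    (hfm : Measurable fun p : ℝ × Sp d × ℝ => f p.1 p.2.1 p.2.2)
    (hf : ∀ t ∈ Ioo (0 : ℝ) 1, ∀ x ∈ Ω, Monotone (f t x))
    (hF : ∀ t ∈ Ioo (0 : ℝ) 1, ∀ x ∈ Ω, ∀ z, HasDerivAt (F t x) (f t x z) z)
    (hfz : MemLp (fun z => f z.2 z.1 0) 2 (muQ Ω))
    (hFz : Integrable (fun z => F z.2 z.1 0) (muQ Ω)) :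
    IsConvexIntegrand (muQ Ω) (fun z => F z.2 z.1) (fun z => f z.2 z.1) where
  meas := hfm.comp (measurable_fst.snd.prodMk (measurable_fst.fst.prodMk measurable_snd))
  mono := ae_mem_muQ.mono fun z hz => hf z.2 hz.2 z.1 hz.1
  deriv := ae_mem_muQ.mono fun z hz => hF z.2 hz.2 z.1 hz.1
  memLp_zero := hfz
  integrable_zero := hFz

lemma extIntegral_congr {α : Type*} [MeasurableSpace α] {μ : Measure α} {f g : α → ℝ}
    (h : f =ᵐ[μ] g) : extIntegral μ f = extIntegral μ g := by
  by_cases hf : Integrable f μ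
  · rw [extIntegral, extIntegral, if_pos hf, if_pos (hf.congr h), integral_congr_ae h]
  · rw [extIntegral, extIntegral, if_neg hf, if_neg fun hg => hf (hg.congr h.symm)]

-- The pointwise sum agrees almost everywhere with a bounded linear map into `L²`, which is the form
-- the duality theorem requires.
open IsConvexIntegrand in
lemma funU1_eq (ζ : Fin r → L2X Ω) (F : ℝ → Sp d → ℝ → ℝ) :
    funU1 ζ F = functional (muQ Ω) (fun z => F z.2 z.1) (expandT ζ) := by
  funext c
  refine extIntegral_congr ?_
  filter_upwards [expandT_apply ζ c] with z hz
  rw [hz]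

open IsConvexIntegrand in
lemma funV1_eq (ζ : Fin r → L2X Ω) (G : Sp d → ℝ → ℝ) :
    funV1 ζ G = functional (muX Ω) G (expandX ζ) := by
  funext c
  refine extIntegral_congr ?_
  filter_upwards [coeFn_expandX ζ c] with x hx
  rw [hx]

/-! ### The coefficient matrices -/

lemma toEuclideanCLM_apply_apply (A : Matrix (Fin r) (Fin r) ℝ) (c : EuclideanSpace ℝ (Fin r))
    (p : Fin r) : Matrix.toEuclideanCLM (𝕜 := ℝ) A c p = ∑ q, A p q * c q := by
  simp [Matrix.ofLp_toEuclideanCLM, Matrix.mulVec, dotProduct]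

lemma toEuclideanCLM_comp_inv {A B : Matrix (Fin r) (Fin r) ℝ} (h : A * B = 1)
    (c : EuclideanSpace ℝ (Fin r)) :
    Matrix.toEuclideanCLM (𝕜 := ℝ) A (Matrix.toEuclideanCLM (𝕜 := ℝ) B c) = c := by
  rw [← mul_apply_eq_comp, ← map_mul, h, map_one, one_apply_eq_self]

lemma compLpL_toEuclideanCLM_comp_inv {A B : Matrix (Fin r) (Fin r) ℝ} (h : A * B = 1)
    (c : L2T r) : (Matrix.toEuclideanCLM (𝕜 := ℝ) A).compLpL 2 muT
      ((Matrix.toEuclideanCLM (𝕜 := ℝ) B).compLpL 2 muT c) = c := by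
  refine Lp.ext ?_
  filter_upwards [ContinuousLinearMap.coeFn_compLpL (Matrix.toEuclideanCLM (𝕜 := ℝ) A)
      ((Matrix.toEuclideanCLM (𝕜 := ℝ) B).compLpL 2 muT c),
    ContinuousLinearMap.coeFn_compLpL (Matrix.toEuclideanCLM (𝕜 := ℝ) B) c] with t h1 h2
  rw [h1, h2, toEuclideanCLM_comp_inv h]

lemma mem_image_iff_of_inverse {α β : Type*} {f : α → β} {g : β → α} (h1 : ∀ x, g (f x) = x)
    (h2 : ∀ y, f (g y) = y) (S : Set α) (y : β) : y ∈ f '' S ↔ g y ∈ S := by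
  rw [image_eq_preimage_of_inverse h1 h2, mem_preimage]

/-! ### The couplings as inclusions -/

section Couplings

variable {ζ : Fin r → L2X Ω} (K : Lp ℝ 2 ((muX Ω).prod (muX Ω)))

lemma integral_projKernel_time (hζ : Orthonormal ℝ ζ) (ρ : L2Q Ω) :
    ∀ᵐ t ∂muT, ∀ᵐ x ∂(muX Ω), ∫ y, projKernel ζ K (x, y) * ρ (y, t) ∂(muX Ω) =
      ∑ p, ((Matrix.toEuclideanCLM (𝕜 := ℝ) (kernelMatrix ζ K)).compLpL 2 muT
        ((expandT ζ).adjoint ρ)) t p * ζ p x := by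
  have hint : ∀ q, ∀ᵐ t ∂muT, Integrable (fun y => ρ (y, t) * ζ q y) (muX Ω) := by
    intro q
    -- The constant coefficient `e_q` expands to `ζ_q` on all of `Q`, so Fubini's theorem makes
    -- `ρ(·,t) ζ_q` integrable for almost every `t`.
    have heL := memLp_smul_single (κ := 1) aestronglyMeasurable_const (by simp) q
    filter_upwards [(L2_integrable_mul ρ (expandT ζ (heL.toLp _))).prod_left_ae,
      ae_ae_of_ae_muQ (expandT_smul_single ζ heL)] with t h1 h2
    refine h1.congr ?_
    filter_upwards [h2] with x hx
    rw [hx, Pi.one_apply, one_mul]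
  filter_upwards [ae_all_iff.2 hint, ae_all_iff.2 (adjoint_expandT_apply ζ ρ),
    ContinuousLinearMap.coeFn_compLpL (Matrix.toEuclideanCLM (𝕜 := ℝ) (kernelMatrix ζ K))
      ((expandT ζ).adjoint ρ)] with t h1 h2 h3
  filter_upwards [integral_projKernel_mul hζ K] with x hx
  rw [hx _ h1]
  refine Finset.sum_congr rfl fun p _ => ?_
  rw [h3, toEuclideanCLM_apply_apply]
  simp_rw [h2]

lemma integral_projKernel_space (hζ : Orthonormal ℝ ζ) (ρ : L2X Ω) :
    ∀ᵐ x ∂(muX Ω), ∫ y, projKernel ζ K (x, y) * ρ y ∂(muX Ω) =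
      ∑ p, Matrix.toEuclideanCLM (𝕜 := ℝ) (kernelMatrix ζ K)
        ((expandX ζ).adjoint ρ) p * ζ p x := by
  filter_upwards [integral_projKernel_mul hζ K] with x hx
  rw [hx _ fun q => L2_integrable_mul ρ (ζ q)]
  refine Finset.sum_congr rfl fun p _ => ?_
  rw [toEuclideanCLM_apply_apply]
  simp_rw [adjoint_expandX_apply]

variable {K}

/-- The nonlocal coupling in the interior as an inclusion. -/
lemma adjoint_expandT_mem_iff (hζ : Orthonormal ℝ ζ) (hK : IsUnit (kernelMatrix ζ K)) {F f : ℝ → Sp d → ℝ → ℝ}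
    (h : IsConvexIntegrand (muQ Ω) (fun z => F z.2 z.1) (fun z => f z.2 z.1))
    (hi : ∀ᵐ t ∂muT, ∀ (c : Fin r → ℝ) (i : Fin r),
      Integrable (fun x => f t x (∑ p, c p * ζ p x) * ζ i x) (muX Ω)) (a : L2T r) (ρ : L2Q Ω) :
    (expandT ζ).adjoint ρ ∈
        ((Matrix.toEuclideanCLM (𝕜 := ℝ) (kernelMatrix ζ K)⁻¹).compLpL 2 muT) ''
          subdifferential (convexDual (funU1 ζ F)) a ↔
      ∀ i, ∀ᵐ t ∂muT, a t i =
        ∫ x, f t x (∫ y, projKernel ζ K (x, y) * ρ (y, t) ∂(muX Ω)) * ζ i x ∂(muX Ω) := by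
  have hdet := (Matrix.isUnit_iff_isUnit_det _).1 hK
  -- Invertibility moves the matrix onto the coefficients of `ρ`. Duality then exchanges the roles
  -- of the point and the subgradient.
  rw [mem_image_iff_of_inverse
      (compLpL_toEuclideanCLM_comp_inv (Matrix.mul_nonsing_inv _ hdet))
      (compLpL_toEuclideanCLM_comp_inv (Matrix.nonsing_inv_mul _ hdet)),
    funU1_eq, h.mem_subdifferential_convexDual_iff, h.mem_subdifferential_expandT_iff hi]
  refine forall_congr' fun i => Filter.eventually_congr ?_
  filter_upwards [integral_projKernel_time K hζ ρ] with t ht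
  refine Eq.congr_right (integral_congr_ae ?_)
  filter_upwards [ht] with x hx
  rw [hx]

/-- The nonlocal coupling at the final time as an inclusion. -/
lemma adjoint_expandX_mem_iff (hζ : Orthonormal ℝ ζ) (hK : IsUnit (kernelMatrix ζ K)) {G g : Sp d → ℝ → ℝ}
    (h : IsConvexIntegrand (muX Ω) G g)
    (hi : ∀ (c : Fin r → ℝ) (i : Fin r),
      Integrable (fun x => g x (∑ p, c p * ζ p x) * ζ i x) (muX Ω))
    (b : EuclideanSpace ℝ (Fin r)) (ρ : L2X Ω) :
    (expandX ζ).adjoint ρ ∈ (Matrix.toEuclideanCLM (𝕜 := ℝ) (kernelMatrix ζ K)⁻¹) ''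
          subdifferential (convexDual (funV1 ζ G)) b ↔
      ∀ i, b i =
        ∫ x, g x (∫ y, projKernel ζ K (x, y) * ρ y ∂(muX Ω)) * ζ i x ∂(muX Ω) := by
  have hdet := (Matrix.isUnit_iff_isUnit_det _).1 hK
  rw [mem_image_iff_of_inverse
      (toEuclideanCLM_comp_inv (Matrix.mul_nonsing_inv _ hdet))
      (toEuclideanCLM_comp_inv (Matrix.nonsing_inv_mul _ hdet)),
    funV1_eq, h.mem_subdifferential_convexDual_iff, h.mem_subdifferential_expandX_iff hi]
  refine forall_congr' fun i => Eq.congr_right (integral_congr_ae ?_)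
  filter_upwards [integral_projKernel_space K hζ ρ] with x hx
  rw [hx]

end Couplings

/-- The local couplings as inclusions. -/
lemma mem_subdifferential_convexDual_local_iff {Z : Type*} [MeasurableSpace Z] {μ : Measure Z}
    [SigmaFinite μ] {F f : Z → ℝ → ℝ} (h : IsConvexIntegrand μ F f) {u v : Lp ℝ 2 μ} :
    u ∈ subdifferential (convexDual fun w : Lp ℝ 2 μ => extIntegral μ fun z => F z (w z)) v ↔
      ∀ᵐ z ∂μ, v z = f z (u z) :=
  (h.mem_subdifferential_convexDual_iff (.id ℝ _)).trans h.mem_subdifferential_id_iff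

end MFG

/-! ### The adjoint formula and the equivalence -/

theorem mainTheorem3 {d r : ℕ} (Ω : TopologicalSpace.Opens (MFG.Sp d))
    (ζ : Fin r → MFG.L2X Ω) (hζ : Orthonormal ℝ ζ)
    (K S : Lp ℝ 2 ((MFG.muX Ω).prod (MFG.muX Ω)))
    (hK : IsUnit (MFG.kernelMatrix ζ K)) (hS : IsUnit (MFG.kernelMatrix ζ S))
    (f₀ f₁ F₀ F₁ : ℝ → MFG.Sp d → ℝ → ℝ) (g₀ g₁ G₀ G₁ : MFG.Sp d → ℝ → ℝ)
    -- the couplings are measurable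
    (hf₀m : Measurable fun p : ℝ × MFG.Sp d × ℝ => f₀ p.1 p.2.1 p.2.2)
    (hf₁m : Measurable fun p : ℝ × MFG.Sp d × ℝ => f₁ p.1 p.2.1 p.2.2)
    (hg₀m : Measurable fun p : MFG.Sp d × ℝ => g₀ p.1 p.2)
    (hg₁m : Measurable fun p : MFG.Sp d × ℝ => g₁ p.1 p.2)
    -- the couplings are increasing in the last variable
    (hf₀ : ∀ t ∈ Ioo (0 : ℝ) 1, ∀ x ∈ Ω, Monotone (f₀ t x))
    (hf₁ : ∀ t ∈ Ioo (0 : ℝ) 1, ∀ x ∈ Ω, Monotone (f₁ t x))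
    (hg₀ : ∀ x ∈ Ω, Monotone (g₀ x))
    (hg₁ : ∀ x ∈ Ω, Monotone (g₁ x))
    -- their antiderivatives in the last variable
    (hF₀ : ∀ t ∈ Ioo (0 : ℝ) 1, ∀ x ∈ Ω, ∀ z, HasDerivAt (F₀ t x) (f₀ t x z) z)
    (hF₁ : ∀ t ∈ Ioo (0 : ℝ) 1, ∀ x ∈ Ω, ∀ z, HasDerivAt (F₁ t x) (f₁ t x z) z)
    (hG₀ : ∀ x ∈ Ω, ∀ z, HasDerivAt (G₀ x) (g₀ x z) z)
    (hG₁ : ∀ x ∈ Ω, ∀ z, HasDerivAt (G₁ x) (g₁ x z) z)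
    -- integrability at the zero density
    (hf₀z : MemLp (fun z => f₀ z.2 z.1 0) 2 (MFG.muQ Ω))
    (hf₁z : MemLp (fun z => f₁ z.2 z.1 0) 2 (MFG.muQ Ω))
    (hg₀z : MemLp (fun x => g₀ x 0) 2 (MFG.muX Ω))
    (hg₁z : MemLp (fun x => g₁ x 0) 2 (MFG.muX Ω))
    (hF₀z : Integrable (fun z => F₀ z.2 z.1 0) (MFG.muQ Ω))
    (hF₁z : Integrable (fun z => F₁ z.2 z.1 0) (MFG.muQ Ω))
    (hG₀z : Integrable (fun x => G₀ x 0) (MFG.muX Ω))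
    (hG₁z : Integrable (fun x => G₁ x 0) (MFG.muX Ω))
    -- the integrals that define the coefficients of the nonlocal couplings converge
    (hf₁i : ∀ᵐ t ∂MFG.muT, ∀ (c : Fin r → ℝ) (i : Fin r),
      Integrable (fun x => f₁ t x (∑ p, c p * ζ p x) * ζ i x) (MFG.muX Ω))
    (hg₁i : ∀ (c : Fin r → ℝ) (i : Fin r),
      Integrable (fun x => g₁ x (∑ p, c p * ζ p x) * ζ i x) (MFG.muX Ω)) :
    -- the adjoint of `C`
    (∀ (ρ : MFG.L2Q Ω) (m : MFG.L2Qd Ω) (ρ₀ ρ₁ : MFG.L2X Ω),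
      (∀ i, ∀ᵐ t ∂MFG.muT,
        ((MFG.opC ζ).adjoint (MFG.DualSpace.mk ρ m ρ₀ ρ₁)).a t i =
          -∫ x, ρ (x, t) * ζ i x ∂(MFG.muX Ω)) ∧
      (∀ i, ((MFG.opC ζ).adjoint (MFG.DualSpace.mk ρ m ρ₀ ρ₁)).b i =
        -∫ x, ρ₁ x * ζ i x ∂(MFG.muX Ω)) ∧
      ((MFG.opC ζ).adjoint (MFG.DualSpace.mk ρ m ρ₀ ρ₁)).α = -ρ ∧
      ((MFG.opC ζ).adjoint (MFG.DualSpace.mk ρ m ρ₀ ρ₁)).β = -ρ₁ ∧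
      ∃ h : MFG.H1 Ω, MFG.IsRobinSolution h (MFG.spaceTimeDiv ρ m ρ₀ ρ₁) 0 0 ∧
        (∀ h' : MFG.H1 Ω, MFG.IsRobinSolution h' (MFG.spaceTimeDiv ρ m ρ₀ ρ₁) 0 0 → h' = h) ∧
        ((MFG.opC ζ).adjoint (MFG.DualSpace.mk ρ m ρ₀ ρ₁)).φ = -h) ∧
    -- the compatibility conditions as an inclusion
    (∀ (s : MFG.PrimalSpace r Ω) (ρ : MFG.L2Q Ω) (m : MFG.L2Qd Ω) (ρ₀ ρ₁ : MFG.L2X Ω),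
      MFG.Compatible ζ K S f₀ f₁ g₀ g₁ s ρ m ρ₀ ρ₁ ↔
        -(MFG.opC ζ).adjoint (MFG.DualSpace.mk ρ m ρ₀ ρ₁) ∈ MFG.opM ζ K S F₀ F₁ G₀ G₁ s) := by
  refine ⟨fun ρ m ρ₀ ρ₁ => ⟨fun i => ?_, fun i => ?_, MFG.adjoint_opC_α ζ ρ m ρ₀ ρ₁,
    MFG.adjoint_opC_β ζ ρ m ρ₀ ρ₁, ?_⟩, fun s ρ m ρ₀ ρ₁ => ?_⟩
  · rw [MFG.adjoint_opC_a]
    filter_upwards [Lp.coeFn_neg ((MFG.expandT ζ).adjoint ρ),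
      MFG.adjoint_expandT_apply ζ ρ i] with t h1 h2
    rw [h1, ← h2]
    rfl
  · rw [MFG.adjoint_opC_b, ← MFG.adjoint_expandX_apply]
    rfl
  · have hinner := MFG.inner_adjoint_opC_φ ζ ρ m ρ₀ ρ₁
    -- The adjoint itself supplies the solution: its last component already represents the
    -- functional, so no separate existence argument is needed.
    refine ⟨-((MFG.opC ζ).adjoint (MFG.DualSpace.mk ρ m ρ₀ ρ₁)).φ,
      (MFG.isRobinSolution_zero_iff _ _).2 fun φ => by rw [inner_neg_left, hinner],
      fun h' hh' => ?_, (neg_neg _).symm⟩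
    refine ext_inner_right ℝ fun φ => ?_
    rw [(MFG.isRobinSolution_zero_iff _ _).1 hh' φ, inner_neg_left, hinner]
  -- The continuity equation says that the functional represented by the last component is zero, and
  -- an element of `H¹` orthogonal to everything vanishes.
  · have hφ : (∀ φ : MFG.H1 Ω, MFG.spaceTimeDiv ρ m ρ₀ ρ₁ φ = 0) ↔
        (-(MFG.opC ζ).adjoint (MFG.DualSpace.mk ρ m ρ₀ ρ₁)).φ = 0 := by
      rw [map_neg, neg_eq_zero]
      simp_rw [← MFG.inner_adjoint_opC_φ ζ ρ m ρ₀ ρ₁]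
      exact ⟨fun h => inner_self_eq_zero.1 (h _), fun h φ => by rw [h, inner_zero_left]⟩
    have ha : (-(MFG.opC ζ).adjoint (MFG.DualSpace.mk ρ m ρ₀ ρ₁)).a =
        (MFG.expandT ζ).adjoint ρ := by rw [map_neg, MFG.adjoint_opC_a, neg_neg]
    have hb : (-(MFG.opC ζ).adjoint (MFG.DualSpace.mk ρ m ρ₀ ρ₁)).b =
        (MFG.expandX ζ).adjoint ρ₁ := by rw [map_neg, MFG.adjoint_opC_b, neg_neg]
    have hα : (-(MFG.opC ζ).adjoint (MFG.DualSpace.mk ρ m ρ₀ ρ₁)).α = ρ := by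
      rw [map_neg, MFG.adjoint_opC_α, neg_neg]
    have hβ : (-(MFG.opC ζ).adjoint (MFG.DualSpace.mk ρ m ρ₀ ρ₁)).β = ρ₁ := by
      rw [map_neg, MFG.adjoint_opC_β, neg_neg]
    have e1 := MFG.adjoint_expandT_mem_iff hζ hK
      (MFG.isConvexIntegrand_muQ hf₁m hf₁ hF₁ hf₁z hF₁z) hf₁i s.a ρ
    have e2 := MFG.adjoint_expandX_mem_iff hζ hS
      (MFG.isConvexIntegrand_muX hg₁m hg₁ hG₁ hg₁z hG₁z) hg₁i s.b ρ₁
    have e3 := MFG.mem_subdifferential_convexDual_local_iff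
      (MFG.isConvexIntegrand_muQ hf₀m hf₀ hF₀ hf₀z hF₀z) (u := ρ) (v := s.α)
    have e4 := MFG.mem_subdifferential_convexDual_local_iff
      (MFG.isConvexIntegrand_muX hg₀m hg₀ hG₀ hg₀z hG₀z) (u := ρ₁) (v := s.β)
    constructor
    · intro h
      refine ⟨?_, ?_, ?_, ?_, hφ.1 h.continuity_eq⟩
      · rw [ha]; exact e1.2 h.a_eq
      · rw [hb]; exact e2.2 h.b_eq
      · rw [hα]; exact e3.2 h.α_eq
      · rw [hβ]; exact e4.2 h.β_eq
    · rintro ⟨h1, h2, h3, h4, h5⟩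
      rw [ha] at h1
      rw [hb] at h2
      rw [hα] at h3
      rw [hβ] at h4
      exact ⟨e1.1 h1, e2.1 h2, e3.1 h3, e4.1 h4, hφ.2 h5⟩
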